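/- Let $\Omega$ be a standard Borel space with an atomless probability measure $\nu$ (equivalently, a probability space isomorphic to $[0,1]$ with the Lebesgue measure on Borel sets). A graphon is a symmetric measurable function $W:\Omega^2\to[0,1]$, modulo equality $\nu^{\otimes 2}$-almost everywhere; let $\mathcal W_0$ be the set of all graphons, with the weak* topology it inherits from $L^\infty(\Omega^2)=L^1(\Omega^2)^*$. A version of $W$ is a graphon $W^\varphi(x,y)=W(\varphi(x),\varphi(y))$ with $\varphi:\Omega\to\Omega$ a measure preserving bijection. For a sequence of graphons $(\Gamma_n)_{n}$ let $\mathbf{LIM}_{\mathrm w*}(\Gamma_1,\Gamma_2,\dots)$, respectively $\mathbf{ACC}_{\mathrm w*}(\Gamma_1,\Gamma_2,\dots)$, be the set of all graphons which are the weak* limit, respectively a weak* accumulation point, of some sequence $\Gamma_1',\Gamma_2',\dots$ where each $\Gamma_n'$ is a version of $\Gamma_n$. The envelope of $W$ is $\langle W\rangle=\mathbf{LIM}_{\mathrm w*}(W,W,W,\dots)$. For a distance function $d$ on a set $X$ and nonempty $L,M\subseteq X$ on which $d$ is bounded put $$d^{\mathrm{Hf}}(L,M)=\max\Big\{\sup_{x\in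 L}\inf_{y\in M}d(x,y),\ \sup_{y\in M}\inf_{x\in L}d(y,x)\Big\}.$$ Let $d_{\mathrm w^*}$ be any metric on $\mathcal W_0$ that induces the weak* topology, or, for any sequence $(A_n)_{n\in\mathbb N}$ of measurable sets that is dense in the measure algebra of $\nu$, the function $$d_{\mathrm w^*}(U,W)=\sum_{n,k\in\mathbb N}2^{-(n+k)}\Big|\int_{A_n\times A_k}(U-W)\,\mathrm d\nu^{\otimes 2}\Big| .$$ For a vector $\mathbf a=(a_1,\dots,a_q)$ of non-negative reals with sum $1$ let $\mathcal S_{\mathbf a}(W)$ be the set of all matrices $M\in\mathbb R^{q\times q}$ of the form $M_{ij}=\int_{\Omega_i\times\Omega_j}W\,\mathrm d\nu^{\otimes 2}$, where $\Omega=\Omega_1\sqcup\dots\sqcup\Omega_q$ is a measurable partition with $\nu(\Omega_i)=a_i$ for every $i$. Let $d_1^{\mathrm{Hf}}$ be the Hausdorff distance of sets of $q\times q$ matrices derived from $\|M-N\|_1=\sum_{i,j}|M_{ij}-N_{ij}|$. Then for every sequence $\Gamma_1,\Gamma_2,\Gamma_3,\dots$ of graphons the following are equivalent: (a) $\mathbf{LIM}_{\mathrm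 w*}(\Gamma_1,\Gamma_2,\dots)=\mathbf{ACC}_{\mathrm w*}(\Gamma_1,\Gamma_2,\dots)$; (b) the sequence $\langle\Gamma_1\rangle,\langle\Gamma_2\rangle,\langle\Gamma_3\rangle,\dots$ is Cauchy with respect to $d_{\mathrm w^*}^{\mathrm{Hf}}$; (c) for every $q$ and every vector $\mathbf a=(a_1,\dots,a_q)$ of non-negative reals with sum $1$, the sequence $\mathcal S_{\mathbf a}(\Gamma_1),\mathcal S_{\mathbf a}(\Gamma_2),\mathcal S_{\mathbf a}(\Gamma_3),\dots$ is Cauchy with respect to $d_1^{\mathrm{Hf}}$. -/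

import Mathlib

open MeasureTheory Filter Topology Set

noncomputable section

/-- Graphons on a probability space `(Ω, ν)`: symmetric measurable functions `Ω² → [0,1]`,
identified when they agree almost everywhere. (An almost everywhere class whose values are almost
everywhere symmetric and in `[0,1]` has a representative with these properties everywhere.) -/
@[ext]
structure Graphon {Ω : Type*} [MeasurableSpace Ω] (ν : Measure Ω) where
  /-- the class of the graphon modulo null sets -/
  toAEEqFun : (Ω × Ω) →ₘ[ν.prod ν] ℝ
  mem_Icc : ∀ᵐ p ∂(ν.prod ν), toAEEqFun p ∈ Set.Icc (0 : ℝ) 1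
  symm : ∀ᵐ p ∂(ν.prod ν), toAEEqFun p.swap = toAEEqFun p

namespace Graphon

variable {Ω : Type*} [MeasurableSpace Ω] {ν : Measure Ω}

/-- `U` is a version of `W`: `U(x,y) = W(φ(x),φ(y))` almost everywhere, for some measure preserving
bijection `φ` of `Ω`. -/
def IsVersion (U W : Graphon ν) : Prop :=
  ∃ φ : Ω ≃ᵐ Ω, MeasurePreserving φ ν ν ∧
    ∀ᵐ p ∂(ν.prod ν), U.toAEEqFun p = W.toAEEqFun (φ p.1, φ p.2)

/-- The weak* topology on graphons, as a subset of `L^∞(Ω²)`, the dual of `L¹(Ω²)`: the coarsest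
topology for which `W ↦ ∫ f W` is continuous for every `f ∈ L¹(Ω²)`. -/
@[reducible] def weakStarTopology (ν : Measure Ω) : TopologicalSpace (Graphon ν) :=
  TopologicalSpace.induced
    (fun (W : Graphon ν) (f : Lp ℝ 1 (ν.prod ν)) => ∫ p, f p * W.toAEEqFun p ∂(ν.prod ν))
    Pi.topologicalSpace

instance : TopologicalSpace (Graphon ν) := weakStarTopology ν

/-- The set `LIM` of all weak* limits of sequences of versions of the `Γ n`. -/
def LIM (Γ : ℕ → Graphon ν) : Set (Graphon ν) :=
  {W | ∃ U : ℕ → Graphon ν, (∀ n, IsVersion (U n) (Γ n)) ∧ Tendsto U atTop (𝓝 W)}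

/-- The set `ACC` of all weak* accumulation points of sequences of versions of the `Γ n`. -/
def ACC (Γ : ℕ → Graphon ν) : Set (Graphon ν) :=
  {W | ∃ U : ℕ → Graphon ν, (∀ n, IsVersion (U n) (Γ n)) ∧ MapClusterPt W atTop U}

/-- The envelope `⟨W⟩ = LIM (W, W, W, …)`. -/
def envelope (W : Graphon ν) : Set (Graphon ν) :=
  LIM fun _ : ℕ => W

/-- `d` is a metric on the set of graphons which induces the weak* topology. -/
def IsWeakStarMetric (d : Graphon ν → Graphon ν → ℝ) : Prop :=
  ∃ m : MetricSpace (Graphon ν),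
    m.toPseudoMetricSpace.toUniformSpace.toTopologicalSpace = weakStarTopology ν ∧
      ∀ U W, d U W = m.dist U W

/-- The sets `A 0, A 1, …` are measurable and dense in the measure algebra of `ν`. -/
def IsDenseInMeasureAlgebra (ν : Measure Ω) (A : ℕ → Set Ω) : Prop :=
  (∀ n, MeasurableSet (A n)) ∧
    ∀ S, MeasurableSet S → ∀ ε : ℝ, 0 < ε → ∃ n, ν.real (symmDiff S (A n)) < ε

/-- The function `(U, W) ↦ ∑_{n,k} 2^{-(n+k)} |∫_{A_n × A_k} (U - W)|`. -/
def weakStarDist (A : ℕ → Set Ω) (U W : Graphon ν) : ℝ :=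
  ∑' nk : ℕ × ℕ, ((2 : ℝ) ^ (nk.1 + nk.2))⁻¹ *
    |∫ p in A nk.1 ×ˢ A nk.2, (U.toAEEqFun p - W.toAEEqFun p) ∂(ν.prod ν)|

/-- The set `S_a(W)` of all matrices `M` with `M i j = ∫_{Ω_i × Ω_j} W`, for a measurable partition
`Ω = Ω_1 ⊔ … ⊔ Ω_q` with `ν(Ω_i) = a_i`. -/
def multiwayCuts {q : ℕ} (a : Fin q → ℝ) (W : Graphon ν) : Set (Matrix (Fin q) (Fin q) ℝ) :=
  {M | ∃ P : Fin q → Set Ω, (∀ i, MeasurableSet (P i)) ∧ (∀ i j, i ≠ j → Disjoint (P i) (P j)) ∧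
    (⋃ i, P i) = Set.univ ∧ (∀ i, ν.real (P i) = a i) ∧
      ∀ i j, M i j = ∫ p in P i ×ˢ P j, W.toAEEqFun p ∂(ν.prod ν)}

end Graphon

/-- The entrywise `ℓ₁`-distance of two square matrices. -/
def matrixL1Dist {q : ℕ} (M N : Matrix (Fin q) (Fin q) ℝ) : ℝ :=
  ∑ i, ∑ j, |M i j - N i j|

/-- The Hausdorff distance of two sets with respect to a distance function `d`. It is used only for
nonempty sets on which `d` is bounded. -/
def hausdorffDistOf {X : Type*} (d : X → X → ℝ) (L M : Set X) : ℝ :=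
  max (⨆ x : L, ⨅ y : M, d x y) (⨆ y : M, ⨅ x : L, d y x)

/-- The sequence `x` is Cauchy with respect to the distance function `d`. -/
def IsCauchyFor {X : Type*} (d : X → X → ℝ) (x : ℕ → X) : Prop :=
  ∀ ε : ℝ, 0 < ε → ∃ N : ℕ, ∀ m n : ℕ, N ≤ m → N ≤ n → d (x m) (x n) < ε

end

/-! Integration against graphons identifies them with a pointwise closed subset of the unit ball of
the dual of `L¹(Ω²)`, so the weak* topology is compact. Any metric inducing it thus makes the
graphons a compact metric space, and both equivalences reduce to one condition: the sets of versions
of `Γ n` are eventually uniformly close to each other (`IsMutuallyClose`).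

(a) is this condition by a general fact on nonempty subsets of a compact metric space: lower and
upper limits coincide exactly for Hausdorff-Cauchy sequences (`lower_limit_eq_upper_limit_iff`). (b)
is this condition because an envelope is the closure of the set of versions, and passing to closures
does not affect mutual closeness.

For (c), fix one labelling `c` with cells of sizes `a`. Any other such labelling is carried to `c`
by a measure preserving bijection, up to a null set (`exists_measurePreserving_label_comp`), so the
set of multiway cuts of `W` is the image of the versions of `W` under the single map `cutMatrix c`
(`multiwayCuts_eq_image`). That map is uniformly continuous by compactness, which transfers
closeness from graphons to matrices. Conversely, rectangle integrals separate graphons, so by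
compactness closeness up to `ε` is forced by finitely many of them, and these can all be read off
one matrix `cutMatrix c` (`exists_label_dist_lt`).

The explicit distance is covered too: it is continuous for the compact topology and separates
points, so it induces that topology. -/

noncomputable section

/-- Uniform form of the Cauchy property of a sequence of sets with respect to the Hausdorff
distance: eventually every point of one set is close to some point of any other one. -/
def IsMutuallyClose {X : Type*} (d : X → X → ℝ) (S : ℕ → Set X) : Prop :=
  ∀ ε : ℝ, 0 < ε → ∃ N : ℕ, ∀ m n : ℕ, N ≤ m → N ≤ n → ∀ x ∈ S m, ∃ y ∈ S n, d x y < ε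

/-! ### Hausdorff distances with real-valued suprema and infima -/

section HausdorffDistOf

variable {X : Type*} {d : X → X → ℝ}

lemma hausdorffDistOf_le {L M : Set X} (hd : ∀ x y, 0 ≤ d x y) {ε : ℝ} (hε : 0 ≤ ε)
    (h₁ : ∀ x ∈ L, ∃ y ∈ M, d x y ≤ ε) (h₂ : ∀ y ∈ M, ∃ x ∈ L, d y x ≤ ε) :
    hausdorffDistOf d L M ≤ ε := by
  have aux : ∀ {A B : Set X}, (∀ x ∈ A, ∃ y ∈ B, d x y ≤ ε) →
      (⨆ x : A, ⨅ y : B, d x y) ≤ ε := by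
    intro A B h
    refine Real.iSup_le (fun x => ?_) hε
    obtain ⟨y, hy, hxy⟩ := h x x.2
    exact (ciInf_le ⟨0, by rintro _ ⟨z, rfl⟩; exact hd _ _⟩ (⟨y, hy⟩ : B)).trans hxy
  exact max_le (aux h₁) (aux h₂)

/-- The real supremum of an unbounded family and the real infimum of an empty one both default to
`0`; the bound `C` and the nonemptiness of `M` exclude these cases. -/
lemma exists_lt_of_hausdorffDistOf_lt {L M : Set X} (hd : ∀ x y, 0 ≤ d x y) {C : ℝ}
    (hC : ∀ x ∈ L, ∀ y ∈ M, d x y ≤ C) (hM : M.Nonempty) {ε : ℝ}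
    (h : hausdorffDistOf d L M < ε) : ∀ x ∈ L, ∃ y ∈ M, d x y < ε := by
  intro x hx
  have : Nonempty M := hM.to_subtype
  have hb : ∀ z : X, BddBelow (range fun y : M => d z y) :=
    fun z => ⟨0, by rintro _ ⟨y, rfl⟩; exact hd _ _⟩
  have hB : BddAbove (range fun x : L => ⨅ y : M, d x y) := by
    refine ⟨C, ?_⟩
    rintro _ ⟨z, rfl⟩
    obtain ⟨y, hy⟩ := hM
    exact (ciInf_le (hb z) (⟨y, hy⟩ : M)).trans (hC z z.2 y hy)
  have h1 : (⨅ y : M, d x y) < ε :=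
    ((le_ciSup hB (⟨x, hx⟩ : L)).trans (le_max_left _ _)).trans_lt h
  obtain ⟨y, hy⟩ := exists_lt_of_ciInf_lt h1
  exact ⟨y, y.2, hy⟩

lemma isCauchyFor_hausdorffDistOf_iff {S : ℕ → Set X} (hd : ∀ x y, 0 ≤ d x y) {C : ℝ}
    (hC : ∀ m n, ∀ x ∈ S m, ∀ y ∈ S n, d x y ≤ C) (hS : ∀ n, (S n).Nonempty) :
    IsCauchyFor (hausdorffDistOf d) S ↔ IsMutuallyClose d S := by
  constructor
  · intro h ε hε
    obtain ⟨N, hN⟩ := h ε hε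
    exact ⟨N, fun m n hm hn => exists_lt_of_hausdorffDistOf_lt hd (hC m n) (hS n) (hN m n hm hn)⟩
  · intro h ε hε
    obtain ⟨N, hN⟩ := h (ε / 2) (half_pos hε)
    refine ⟨N, fun m n hm hn => lt_of_le_of_lt ?_ (half_lt_self hε)⟩
    refine hausdorffDistOf_le hd (half_pos hε).le ?_ ?_
    · intro x hx
      obtain ⟨y, hy, hxy⟩ := hN m n hm hn x hx
      exact ⟨y, hy, hxy.le⟩
    · intro x hx
      obtain ⟨y, hy, hxy⟩ := hN n m hn hm x hx
      exact ⟨y, hy, hxy.le⟩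

/-- Both suprema run over an empty type and take the default value `0`. -/
lemma isCauchyFor_hausdorffDistOf_of_isEmpty {S : ℕ → Set X} (hS : ∀ n, S n = ∅) :
    IsCauchyFor (hausdorffDistOf d) S := by
  intro ε hε
  refine ⟨0, fun m n _ _ => ?_⟩
  simp [hausdorffDistOf, hS, hε]

end HausdorffDistOf

/-! ### Lower and upper limits of sets in a compact metric space -/

section Compact

variable {X : Type*} [MetricSpace X] {V : ℕ → Set X}

lemma isMutuallyClose_closure_iff :
    IsMutuallyClose dist (fun n => closure (V n)) ↔ IsMutuallyClose dist V := by
  constructor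
  · intro h ε hε
    obtain ⟨N, hN⟩ := h (ε / 2) (half_pos hε)
    refine ⟨N, fun m n hm hn x hx => ?_⟩
    obtain ⟨y, hy, hxy⟩ := hN m n hm hn x (subset_closure hx)
    obtain ⟨z, hz, hyz⟩ := Metric.mem_closure_iff.1 hy (ε / 2) (half_pos hε)
    exact ⟨z, hz, by linarith [dist_triangle x y z]⟩
  · intro h ε hε
    obtain ⟨N, hN⟩ := h (ε / 2) (half_pos hε)
    refine ⟨N, fun m n hm hn x hx => ?_⟩
    obtain ⟨y, hy, hxy⟩ := Metric.mem_closure_iff.1 hx (ε / 2) (half_pos hε)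
    obtain ⟨z, hz, hyz⟩ := hN m n hm hn y hy
    exact ⟨z, subset_closure hz, by linarith [dist_triangle x y z]⟩

/-- One sequence of almost nearest points serves all `ε` at once. The slack `1 / (n + 1)` is there
because the distance to `V n` need not be attained. -/
lemma exists_tendsto_iff (hV : ∀ n, (V n).Nonempty) (x : X) :
    (∃ U : ℕ → X, (∀ n, U n ∈ V n) ∧ Tendsto U atTop (𝓝 x)) ↔
      ∀ ε : ℝ, 0 < ε → ∀ᶠ n in atTop, ∃ y ∈ V n, dist y x < ε := by
  constructor
  · rintro ⟨U, hU, h⟩ ε hε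
    filter_upwards [Metric.tendsto_nhds.1 h ε hε] with n hn using ⟨U n, hU n, hn⟩
  · intro h
    have key : ∀ n, ∃ y ∈ V n, dist y x < Metric.infDist x (V n) + 1 / ((n : ℝ) + 1) := by
      intro n
      obtain ⟨y, hy, hxy⟩ := (Metric.infDist_lt_iff (hV n)).1
        (lt_add_of_pos_right (Metric.infDist x (V n)) (Nat.one_div_pos_of_nat (n := n)))
      exact ⟨y, hy, by rwa [dist_comm]⟩
    choose U hU hUx using key
    refine ⟨U, hU, Metric.tendsto_nhds.2 fun ε hε => ?_⟩
    filter_upwards [h (ε / 2) (half_pos hε),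
      (tendsto_one_div_add_atTop_nhds_zero_nat (𝕜 := ℝ)).eventually_lt_const (half_pos hε)]
      with n ⟨y, hy, hyx⟩ hn
    have := Metric.infDist_le_dist_of_mem (x := x) hy
    rw [dist_comm] at this
    linarith [hUx n]

lemma exists_mapClusterPt_iff (hV : ∀ n, (V n).Nonempty) (x : X) :
    (∃ U : ℕ → X, (∀ n, U n ∈ V n) ∧ MapClusterPt x atTop U) ↔
      ∀ ε : ℝ, 0 < ε → ∃ᶠ n in atTop, ∃ y ∈ V n, dist y x < ε := by
  constructor
  · rintro ⟨U, hU, h⟩ ε hε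
    exact (h.frequently (Metric.ball_mem_nhds x hε)).mono fun n hn => ⟨U n, hU n, hn⟩
  · intro h
    have key : ∀ n, ∃ y ∈ V n, dist y x < Metric.infDist x (V n) + 1 / ((n : ℝ) + 1) := by
      intro n
      obtain ⟨y, hy, hxy⟩ := (Metric.infDist_lt_iff (hV n)).1
        (lt_add_of_pos_right (Metric.infDist x (V n)) (Nat.one_div_pos_of_nat (n := n)))
      exact ⟨y, hy, by rwa [dist_comm]⟩
    choose U hU hUx using key
    refine ⟨U, hU, Metric.nhds_basis_ball.mapClusterPt_iff_frequently.2 fun ε hε => ?_⟩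
    refine ((h (ε / 2) (half_pos hε)).and_eventually
      ((tendsto_one_div_add_atTop_nhds_zero_nat (𝕜 := ℝ)).eventually_lt_const
        (half_pos hε))).mono ?_
    rintro n ⟨⟨y, hy, hyx⟩, hn⟩
    have := Metric.infDist_le_dist_of_mem (x := x) hy
    rw [dist_comm] at this
    rw [Metric.mem_ball]
    linarith [hUx n]

/-- In a compact metric space the lower and the upper limit of a sequence of nonempty sets agree if
and only if the sequence is Cauchy for the Hausdorff distance. -/
lemma lower_limit_eq_upper_limit_iff [CompactSpace X] (hV : ∀ n, (V n).Nonempty) :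
    {x | ∃ U : ℕ → X, (∀ n, U n ∈ V n) ∧ Tendsto U atTop (𝓝 x)} =
      {x | ∃ U : ℕ → X, (∀ n, U n ∈ V n) ∧ MapClusterPt x atTop U} ↔
    IsMutuallyClose dist V := by
  constructor
  · intro h
    have h' : ∀ x : X, (∀ ε : ℝ, 0 < ε → ∃ᶠ n in atTop, ∃ y ∈ V n, dist y x < ε) →
        ∀ ε : ℝ, 0 < ε → ∀ᶠ n in atTop, ∃ y ∈ V n, dist y x < ε := by
      intro x hx
      rw [← exists_tendsto_iff hV]
      rw [← exists_mapClusterPt_iff hV] at hx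
      exact (Set.ext_iff.1 h x).2 hx
    intro ε hε
    by_contra hcon
    push Not at hcon
    choose m n hm hn x hx hxy using hcon
    -- The points `x k ∈ V (m k)` stay `ε`-far from `V (n k)`. Their cluster point `z` lies in the
    -- upper limit, hence in the lower one, so `V (n k)` comes `ε / 2`-close to `z` while `x k` does
    -- too: a contradiction.
    obtain ⟨z, -, hz⟩ := isCompact_univ.exists_mapClusterPt (f := atTop) (u := x)
      (by simp)
    have hev := h' z ?_ (ε / 2) (half_pos hε)
    · obtain ⟨N, hN⟩ := eventually_atTop.1 hev
      obtain ⟨k, hk, hkz⟩ := ((hz.frequently (Metric.ball_mem_nhds z (half_pos hε))).and_eventually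
        (eventually_ge_atTop N)).exists
      obtain ⟨y, hy, hyz⟩ := hN (n k) (hkz.trans (hn k))
      have h1 := hxy k y hy
      have := dist_triangle_right (x k) y z
      linarith
    · intro δ hδ
      rw [frequently_atTop]
      intro a
      obtain ⟨k, hk, hka⟩ := ((hz.frequently (Metric.ball_mem_nhds z hδ)).and_eventually
        (eventually_ge_atTop a)).exists
      exact ⟨m k, hka.trans (hm k), x k, hx k, hk⟩
  · intro h
    ext x
    simp only [mem_ofPred_eq]
    rw [exists_tendsto_iff hV, exists_mapClusterPt_iff hV]
    refine ⟨fun hx ε hε => (hx ε hε).frequently, fun hx ε hε => ?_⟩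
    obtain ⟨N, hN⟩ := h (ε / 2) (half_pos hε)
    obtain ⟨m, ⟨y, hy, hyx⟩, hm⟩ := ((hx (ε / 2) (half_pos hε)).and_eventually
      (eventually_ge_atTop N)).exists
    filter_upwards [eventually_ge_atTop N] with n hn
    obtain ⟨z, hz, hyz⟩ := hN m n hm hn y hy
    exact ⟨z, hz, by linarith [dist_triangle_left z x y]⟩

end Compact

/-! ### Distribution functions of atomless laws on the line -/

section Cdf

open ProbabilityTheory

variable (μ : Measure ℝ) [IsProbabilityMeasure μ]

lemma continuous_cdf [NullSingletonClass μ] : Continuous (cdf μ) := by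
  rw [continuous_iff_continuousAt]
  intro x
  rw [(monotone_cdf μ).continuousAt_iff_leftLim_eq_rightLim, StieltjesFunction.rightLim_eq]
  have h := (cdf μ).measure_singleton x
  rw [measure_cdf, measure_singleton] at h
  have h1 := ENNReal.ofReal_eq_zero.1 h.symm
  have h2 := (monotone_cdf μ).leftLim_le (le_refl x)
  linarith

/-- A nonempty sublevel set is `Iic (sSup S)`, and its measure is the distribution function at `sSup
S`; continuity forces the value `t` there. An empty one forces `t = 0` by the limit at `-∞`. -/
lemma measureReal_cdf_le [NullSingletonClass μ] {t : ℝ} (h0 : 0 ≤ t) (h1 : t < 1) :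
    μ.real {x | cdf μ x ≤ t} = t := by
  set S := {x | cdf μ x ≤ t} with hS
  have hcl : IsClosed S := isClosed_le (continuous_cdf μ) continuous_const
  rcases S.eq_empty_or_nonempty with he | hne
  · rw [he, measureReal_empty]
    refine le_antisymm h0 (le_of_tendsto_of_tendsto tendsto_const_nhds (tendsto_cdf_atBot μ) ?_)
    refine Eventually.of_forall fun x => ?_
    have : x ∉ S := he ▸ notMem_empty x
    exact (not_le.1 this).le
  · have hbdd : BddAbove S := by
      obtain ⟨b, hb⟩ := (Tendsto.eventually_const_lt h1 (tendsto_cdf_atTop μ)).exists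
      exact ⟨b, fun x hx => le_of_lt ((monotone_cdf μ).reflect_lt (lt_of_le_of_lt hx hb))⟩
    have hmem : sSup S ∈ S := hcl.csSup_mem hne hbdd
    have hIic : S = Iic (sSup S) := by
      ext x
      exact ⟨fun hx => le_csSup hbdd hx, fun hx => (monotone_cdf μ hx).trans hmem⟩
    rw [hIic, ← cdf_eq_real]
    refine le_antisymm hmem ?_
    refine ge_of_tendsto (x := 𝓝[>] (sSup S)) (f := cdf μ)
      ((continuous_cdf μ).continuousAt.tendsto.mono_left nhdsWithin_le_nhds) ?_
    filter_upwards [self_mem_nhdsWithin] with x hx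
    have : x ∉ S := fun h => (not_le.2 hx) (le_csSup hbdd h)
    exact (not_le.1 this).le

/-- The distribution function of an atomless law is uniformly distributed. -/
lemma map_cdf_eq_uniform [NullSingletonClass μ] :
    μ.map (cdf μ) = volume.restrict (Icc (0 : ℝ) 1) := by
  have hm : Measurable (cdf μ) := (continuous_cdf μ).measurable
  have : IsProbabilityMeasure (μ.map (cdf μ)) := Measure.isProbabilityMeasure_map hm.aemeasurable
  refine Measure.ext_of_Iic _ _ fun t => ?_
  rw [Measure.map_apply hm measurableSet_Iic, Measure.restrict_apply measurableSet_Iic]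
  rcases lt_or_ge t 0 with ht | ht
  · have e1 : cdf μ ⁻¹' Iic t = ∅ := by
      ext x; simpa using ht.trans_le (cdf_nonneg μ x)
    have e2 : Iic t ∩ Icc (0 : ℝ) 1 = ∅ := by
      ext x
      simp only [mem_inter_iff, mem_Iic, mem_Icc, mem_empty_iff_false, iff_false]
      rintro ⟨h1, h2, -⟩
      linarith
    rw [e1, e2]; simp
  rcases lt_or_ge t 1 with h1 | h1
  · have e2 : Iic t ∩ Icc (0 : ℝ) 1 = Icc 0 t := by
      ext x
      simp only [mem_inter_iff, mem_Iic, mem_Icc]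
      constructor
      · rintro ⟨h1, h2, -⟩; exact ⟨h2, h1⟩
      · rintro ⟨h2, h3⟩; exact ⟨h3, h2, by linarith⟩
    rw [e2, Real.volume_Icc, sub_zero, ← measureReal_cdf_le μ ht h1, ofReal_measureReal,
      measureReal_cdf_le μ ht h1]
    rfl
  · have e1 : cdf μ ⁻¹' Iic t = univ := by
      ext x; simpa using (cdf_le_one μ x).trans h1
    have e2 : Iic t ∩ Icc (0 : ℝ) 1 = Icc 0 1 := by
      ext x
      simp only [mem_inter_iff, mem_Iic, mem_Icc, and_iff_right_iff_imp]
      rintro ⟨-, h⟩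
      linarith
    rw [e1, e2]; simp

/-- If a monotone function agrees at `x < y`, it takes the same value at a rational in between. So
it suffices to discard the countably many level sets through rationals, each null since the function
is uniformly distributed. -/
lemma exists_injOn_cdf [NullSingletonClass μ] :
    ∃ X : Set ℝ, MeasurableSet X ∧ μ Xᶜ = 0 ∧ InjOn (cdf μ) X := by
  have hm : Measurable (cdf μ) := (continuous_cdf μ).measurable
  refine ⟨(⋃ r : ℚ, cdf μ ⁻¹' {cdf μ r})ᶜ, ?_, ?_, ?_⟩
  · exact (MeasurableSet.iUnion fun r => hm (measurableSet_singleton _)).compl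
  · rw [compl_compl, measure_iUnion_null_iff]
    intro r
    rw [← Measure.map_apply hm (measurableSet_singleton _), map_cdf_eq_uniform]
    exact measure_singleton _
  · have key : ∀ x ∈ (⋃ r : ℚ, cdf μ ⁻¹' {cdf μ r})ᶜ, ∀ y, x < y → cdf μ x ≠ cdf μ y := by
      intro x hx y hxy he
      obtain ⟨r, h1, h2⟩ := exists_rat_btwn hxy
      refine hx (mem_iUnion.2 ⟨r, ?_⟩)
      exact le_antisymm (monotone_cdf μ h1.le) (he ▸ monotone_cdf μ h2.le)
    intro x hx y hy he
    rcases lt_trichotomy x y with h | h | h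
    · exact absurd he (key x hx y h)
    · exact h
    · exact absurd he.symm (key y hy x h)

end Cdf

/-! ### Building measure preserving bijections -/

section Patching

variable {Ω : Type*} [MeasurableSpace Ω]

lemma not_countable_of_nullSingletonClass (ν : Measure Ω) [IsProbabilityMeasure ν]
    [NullSingletonClass ν] : ¬ Countable Ω := by
  intro h
  have h0 : ν univ = 0 := (countable_univ (α := Ω)).measure_zero ν
  simp at h0

/-- Under a Borel isomorphism with the plane, the vertical lines are uncountably many disjoint sets,
so all but countably many are null. Such a set is reserved below to keep leftover complements
uncountable, hence Borel isomorphic. -/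
lemma exists_measurableSet_null_not_countable [StandardBorelSpace Ω] (ν : Measure Ω)
    [IsProbabilityMeasure ν] [NullSingletonClass ν] :
    ∃ N : Set Ω, MeasurableSet N ∧ ν N = 0 ∧ ¬ N.Countable := by
  have hR : ¬ Countable (ℝ × ℝ) := fun h => by
    have : Countable ℝ := Function.Injective.countable (f := fun x : ℝ => (x, (0 : ℝ)))
      fun a b hab => congrArg Prod.fst hab
    exact not_countable (α := ℝ) this
  let e : Ω ≃ᵐ ℝ × ℝ :=
    PolishSpace.measurableEquivOfNotCountable (not_countable_of_nullSingletonClass ν) hR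
  let A : ℝ → Set Ω := fun t => {x | (e x).1 = t}
  have hA : ∀ t, MeasurableSet (A t) := fun t =>
    (measurable_fst.comp e.measurable) (measurableSet_singleton t)
  have hdisj : Pairwise (Function.onFun Disjoint A) := by
    intro s t hst
    refine Set.disjoint_left.2 fun x hx hx' => hst ?_
    exact (show (e x).1 = s from hx).symm.trans hx'
  have hc := Measure.countable_meas_pos_of_disjoint_of_meas_iUnion_ne_top ν hA hdisj
    (measure_ne_top _ _)
  obtain ⟨t, ht⟩ : ∃ t, t ∉ {t | 0 < ν (A t)} := by
    by_contra! h
    exact not_countable (α := ℝ) (countable_univ_iff.1 (hc.mono fun t _ => h t))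
  refine ⟨A t, hA t, by simpa using ht, fun hcount => ?_⟩
  have : (univ : Set ℝ).Countable := by
    refine (hcount.image fun x => (e x).2).mono fun s _ => ?_
    exact ⟨e.symm (t, s), by simp [A], by simp⟩
  exact not_countable (α := ℝ) (countable_univ_iff.1 this)

lemma exists_measurableEquiv_of_range_eq {Ω' E : Type*} [MeasurableSpace Ω'] [MeasurableSpace E]
    {a : Ω → E} {b : Ω' → E} (ha : MeasurableEmbedding a) (hb : MeasurableEmbedding b)
    (h : range a = range b) : ∃ e : Ω ≃ᵐ Ω', ∀ x, b (e x) = a x := by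
  have h1 : ∀ x, ∃ y, b y = a x := fun x => (h ▸ mem_range_self x : a x ∈ range b)
  have h2 : ∀ y, ∃ x, a x = b y := fun y => (h ▸ mem_range_self y : b y ∈ range a)
  choose F hF using h1
  choose G hG using h2
  refine ⟨⟨⟨F, G, fun x => ha.injective (by rw [hG, hF]), fun y => hb.injective (by rw [hF, hG])⟩,
    fun s hs => ?_, fun s hs => ?_⟩, hF⟩
  · have : F ⁻¹' s = a ⁻¹' (b '' s) := by
      ext x
      simp only [mem_preimage, mem_image]
      refine ⟨fun hx => ⟨_, hx, hF x⟩, ?_⟩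
      rintro ⟨y, hy, hyx⟩
      rw [← hF x, hb.injective.eq_iff] at hyx
      exact hyx ▸ hy
    exact this ▸ ha.measurable (hb.measurableSet_image.2 hs)
  · have : G ⁻¹' s = b ⁻¹' (a '' s) := by
      ext x
      simp only [mem_preimage, mem_image]
      refine ⟨fun hx => ⟨_, hx, hG x⟩, ?_⟩
      rintro ⟨y, hy, hyx⟩
      rw [← hG x] at hyx
      exact ha.injective hyx ▸ hy
    exact this ▸ hb.measurable (ha.measurableSet_image.2 hs)

/-- A bijection between two measurable sets given by matching the values of two injective
measurable functions extends to the whole space if the complements are uncountable. -/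
lemma exists_measurableEquiv_extend [StandardBorelSpace Ω] {f g : Ω → ℝ} (hf : Measurable f)
    (hg : Measurable g) {X X' : Set Ω} (hX : MeasurableSet X) (hX' : MeasurableSet X')
    (hfX : InjOn f X) (hgX : InjOn g X') (him : f '' X = g '' X')
    (hc : ¬ Xᶜ.Countable) (hc' : ¬ X'ᶜ.Countable) :
    ∃ φ : Ω ≃ᵐ Ω, ∀ x, (x ∈ X → φ x ∈ X' ∧ g (φ x) = f x) ∧ (φ x ∈ X' → x ∈ X) := by
  classical
  have : StandardBorelSpace X := hX.standardBorel
  have : StandardBorelSpace X' := hX'.standardBorel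
  have : StandardBorelSpace ↥(Xᶜ) := hX.compl.standardBorel
  have : StandardBorelSpace ↥(X'ᶜ) := hX'.compl.standardBorel
  have ef : MeasurableEmbedding (fun x : X => f x) :=
    (hf.comp measurable_subtype_coe).measurableEmbedding (injOn_iff_injective.1 hfX)
  have eg : MeasurableEmbedding (fun x : X' => g x) :=
    (hg.comp measurable_subtype_coe).measurableEmbedding (injOn_iff_injective.1 hgX)
  have hr : range (fun x : X => f x) = range (fun x : X' => g x) := by
    rw [← image_eq_range, ← image_eq_range, him]
  obtain ⟨e₁, he₁⟩ := exists_measurableEquiv_of_range_eq ef eg hr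
  let e₂ : ↥(Xᶜ) ≃ᵐ ↥(X'ᶜ) := PolishSpace.measurableEquivOfNotCountable
    (by rwa [countable_coe_iff]) (by rwa [countable_coe_iff])
  let φ : Ω ≃ᵐ Ω := (MeasurableEquiv.sumCompl hX).symm.trans
    ((MeasurableEquiv.sumCongr e₁ e₂).trans (MeasurableEquiv.sumCompl hX'))
  have h1 : ∀ x (hx : x ∈ X), φ x = e₁ ⟨x, hx⟩ := by
    intro x hx
    have : (MeasurableEquiv.sumCompl hX).symm x = Sum.inl ⟨x, hx⟩ := by
      rw [MeasurableEquiv.symm_apply_eq]; rfl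
    simp only [φ, MeasurableEquiv.trans_apply, this]
    rfl
  have h2 : ∀ x (hx : x ∈ Xᶜ), φ x = e₂ ⟨x, hx⟩ := by
    intro x hx
    have : (MeasurableEquiv.sumCompl hX).symm x = Sum.inr ⟨x, hx⟩ := by
      rw [MeasurableEquiv.symm_apply_eq]; rfl
    simp only [φ, MeasurableEquiv.trans_apply, this]
    rfl
  refine ⟨φ, fun x => ⟨fun hx => ?_, fun hx => ?_⟩⟩
  · rw [h1 x hx]
    exact ⟨(e₁ ⟨x, hx⟩).2, he₁ ⟨x, hx⟩⟩
  · by_contra hx'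
    rw [h2 x hx'] at hx
    exact (e₂ ⟨x, hx'⟩).2 hx

/-- Two essentially injective functions with the same law differ by a measure preserving
bijection. -/
theorem exists_measurePreserving_comp_ae_eq [StandardBorelSpace Ω] (ν : Measure Ω)
    [IsProbabilityMeasure ν] [NullSingletonClass ν] {f g : Ω → ℝ} (hf : Measurable f)
    (hg : Measurable g) (hfg : ν.map f = ν.map g) {A B : Set Ω} (hA : MeasurableSet A)
    (hB : MeasurableSet B) (hνA : ν Aᶜ = 0) (hνB : ν Bᶜ = 0) (hfA : InjOn f A) (hgB : InjOn g B) :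
    ∃ φ : Ω ≃ᵐ Ω, MeasurePreserving φ ν ν ∧ ∀ᵐ x ∂ν, g (φ x) = f x := by
  obtain ⟨N, hN, hνN, hNc⟩ := exists_measurableSet_null_not_countable ν
  have him : ∀ {h : Ω → ℝ} {C : Set Ω}, Measurable h → MeasurableSet C → ν Cᶜ = 0 → InjOn h C →
      MeasurableSet (h '' (C \ N)) ∧ ν.map h (h '' (C \ N))ᶜ = 0 := by
    intro h C hh hC hνC hinj
    have hm := (hC.diff hN).image_of_measurable_injOn hh (hinj.mono sdiff_subset)
    refine ⟨hm, ?_⟩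
    rw [Measure.map_apply hh hm.compl]
    refine measure_mono_null (t := Cᶜ ∪ N) ?_ (measure_union_null hνC hνN)
    intro x hx
    by_contra hx'
    simp only [mem_union, mem_compl_iff, not_or, not_not] at hx'
    exact hx ⟨x, hx', rfl⟩
  obtain ⟨hYf, hYf0⟩ := him hf hA hνA hfA
  obtain ⟨hYg, hYg0⟩ := him hg hB hνB hgB
  -- The common values of `f` and `g` are co-null for their shared law. The parts `X`, `X'` lying
  -- over `Y` are co-null with equal images, and both complements contain `N`.
  set Y := f '' (A \ N) ∩ g '' (B \ N) with hY
  have hYm : MeasurableSet Y := hYf.inter hYg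
  have hY0 : ν.map f Yᶜ = 0 := by
    rw [hY, compl_inter]
    exact measure_union_null hYf0 (hfg ▸ hYg0)
  have hX : MeasurableSet ((A \ N) ∩ f ⁻¹' Y) := (hA.diff hN).inter (hf hYm)
  have hX' : MeasurableSet ((B \ N) ∩ g ⁻¹' Y) := (hB.diff hN).inter (hg hYm)
  have hnull : ∀ {h : Ω → ℝ} {C : Set Ω}, Measurable h → ν Cᶜ = 0 → ν.map h Yᶜ = 0 →
      ν ((C \ N) ∩ h ⁻¹' Y)ᶜ = 0 := by
    intro h C hh hνC h0
    rw [Measure.map_apply hh hYm.compl] at h0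
    refine measure_mono_null (t := Cᶜ ∪ N ∪ h ⁻¹' Yᶜ) ?_
      (measure_union_null (measure_union_null hνC hνN) h0)
    intro x hx
    by_contra hx'
    simp only [mem_union, mem_compl_iff, not_or, not_not, mem_preimage] at hx'
    exact hx ⟨hx'.1, hx'.2⟩
  have hX0 := hnull hf hνA hY0
  have hX'0 := hnull hg hνB (hfg ▸ hY0)
  set X := (A \ N) ∩ f ⁻¹' Y with hXdef
  set X' := (B \ N) ∩ g ⁻¹' Y with hX'def
  have hfX : f '' X = Y := by
    rw [hXdef, image_inter_preimage]
    exact inter_eq_right.2 inter_subset_left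
  have hgX' : g '' X' = Y := by
    rw [hX'def, image_inter_preimage]
    exact inter_eq_right.2 inter_subset_right
  have hinjf : InjOn f X := hfA.mono fun x hx => hx.1.1
  have hinjg : InjOn g X' := hgB.mono fun x hx => hx.1.1
  have hNX : N ⊆ Xᶜ := fun x hx hx' => hx'.1.2 hx
  have hNX' : N ⊆ X'ᶜ := fun x hx hx' => hx'.1.2 hx
  obtain ⟨φ, hφ⟩ := exists_measurableEquiv_extend hf hg hX hX' hinjf hinjg (hfX.trans hgX'.symm)
    (fun h => hNc (h.mono hNX)) (fun h => hNc (h.mono hNX'))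
  have haeX : ∀ᵐ x ∂ν, x ∈ X := hX0
  have haeX' : ∀ᵐ x ∂ν, x ∈ X' := hX'0
  refine ⟨φ, ⟨φ.measurable, ?_⟩, haeX.mono fun x hx => ((hφ x).1 hx).2⟩
  ext S hS
  rw [Measure.map_apply φ.measurable hS]
  have hT : MeasurableSet (g '' (S ∩ X')) :=
    (hS.inter hX').image_of_measurable_injOn hg (hinjg.mono inter_subset_right)
  -- Up to null sets, `φ ⁻¹' S` and `S` are the preimages under `f` and `g` of the same Borel set of
  -- values.
  calc ν (φ ⁻¹' S) = ν (f ⁻¹' (g '' (S ∩ X'))) := by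
        refine measure_congr (haeX.mono fun x hx => propext ?_)
        obtain ⟨hx1, hx2⟩ := (hφ x).1 hx
        constructor
        · intro h
          exact ⟨φ x, ⟨h, hx1⟩, hx2⟩
        · rintro ⟨y, ⟨hyS, hyX⟩, hy⟩
          rw [← hx2] at hy
          have := hinjg hyX hx1 hy
          exact show φ x ∈ S from this ▸ hyS
    _ = ν (g ⁻¹' (g '' (S ∩ X'))) := by
        rw [← Measure.map_apply hf hT, ← Measure.map_apply hg hT, hfg]
    _ = ν S := by
        refine measure_congr (haeX'.mono fun x hx => propext ?_)
        constructor
        · rintro ⟨y, ⟨hyS, hyX⟩, hy⟩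
          exact show x ∈ S from hinjg hyX hx hy ▸ hyS
        · intro h
          exact ⟨x, ⟨h, hx⟩, rfl⟩

end Patching

/-! ### Labellings with equal cell sizes -/

section Labels

open ProbabilityTheory

variable {Ω : Type*} [MeasurableSpace Ω] [StandardBorelSpace Ω]

/-- A measurable labelling of an atomless probability space is essentially a monotone function of a
uniformly distributed, essentially injective variable. -/
lemma exists_uniform_of_label (ν : Measure Ω) [IsProbabilityMeasure ν] [NullSingletonClass ν]
    {c : Ω → ℕ} (hc : Measurable c) :
    ∃ f : Ω → ℝ, Measurable f ∧ ν.map f = volume.restrict (Icc (0 : ℝ) 1) ∧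
      (∃ A, MeasurableSet A ∧ ν Aᶜ = 0 ∧ InjOn f A) ∧
      ∀ x, ν.real {y | c y < c x} ≤ f x ∧ f x ≤ ν.real {y | c y < c x + 1} := by
  obtain ⟨e, he⟩ := exists_measurableEmbedding_real Ω
  set u : Ω → ℝ := fun x => Real.sigmoid (e x) with hu
  have hum : Measurable u := _root_.continuous_sigmoid.measurable.comp he.measurable
  have huinj : Function.Injective u := Real.sigmoid_strictMono.injective.comp he.injective
  have hu0 : ∀ x, 0 < u x := fun x => Real.sigmoid_pos _
  have hu1 : ∀ x, u x < 1 := fun x => Real.sigmoid_lt_one _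
  -- Since `0 < u < 1`, `w` is injective, so its law is atomless, and `w` sorts points by label. Its
  -- distribution function at an integer `n` is the measure of `{c < n}`.
  set w : Ω → ℝ := fun x => (c x : ℝ) + u x with hw
  have hwm : Measurable w := (measurable_from_nat.comp hc).add hum
  have hfl : ∀ x, ⌊w x⌋ = (c x : ℤ) := fun x => by
    rw [Int.floor_eq_iff]
    simp only [hw, Int.cast_natCast]
    exact ⟨by linarith [hu0 x], by linarith [hu1 x]⟩
  have hwinj : Function.Injective w := by
    intro x y hxy
    have h1 : c x = c y := by
      have := congrArg Int.floor hxy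
      rw [hfl, hfl] at this
      exact_mod_cast this
    apply huinj
    simp only [hw, h1] at hxy
    linarith
  have hle : ∀ (n : ℕ) x, w x ≤ n ↔ c x < n := by
    intro n x
    simp only [hw]
    constructor
    · intro h
      have : (c x : ℝ) < n := by linarith [hu0 x]
      exact_mod_cast this
    · intro h
      have : (c x : ℝ) + 1 ≤ n := by exact_mod_cast h
      linarith [hu1 x]
  set μ := ν.map w with hμ
  have : IsProbabilityMeasure μ := Measure.isProbabilityMeasure_map hwm.aemeasurable
  have : NullSingletonClass μ := ⟨fun t => by
    rw [hμ, Measure.map_apply hwm (measurableSet_singleton t)]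
    exact (Set.subsingleton_singleton.preimage hwinj).measure_zero ν⟩
  have hcdf : ∀ n : ℕ, cdf μ n = ν.real {y | c y < n} := by
    intro n
    rw [cdf_eq_real, measureReal_def, hμ, Measure.map_apply hwm measurableSet_Iic, measureReal_def]
    congr 2
    ext x
    exact hle n x
  obtain ⟨X, hX, hX0, hXinj⟩ := exists_injOn_cdf μ
  have hFm : Measurable (cdf μ) := (continuous_cdf μ).measurable
  refine ⟨cdf μ ∘ w, hFm.comp hwm, ?_, ⟨w ⁻¹' X, hwm hX, ?_, ?_⟩, fun x => ⟨?_, ?_⟩⟩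
  · rw [← Measure.map_map hFm hwm, map_cdf_eq_uniform]
  · rw [← preimage_compl, ← Measure.map_apply hwm hX.compl, hX0]
  · exact fun x hx y hy h => hwinj (hXinj hx hy h)
  · rw [← hcdf]
    exact monotone_cdf μ (by simp only [hw]; linarith [hu0 x])
  · rw [← hcdf]
    exact monotone_cdf μ (by simp only [hw]; push_cast; linarith [hu1 x])

/-- Two labellings of an atomless standard probability space with the same law differ by a measure
preserving bijection. -/
theorem exists_measurePreserving_label_comp (ν : Measure Ω) [IsProbabilityMeasure ν]
    [NullSingletonClass ν] {c c' : Ω → ℕ} (hc : Measurable c) (hc' : Measurable c')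
    (h : ν.map c = ν.map c') :
    ∃ φ : Ω ≃ᵐ Ω, MeasurePreserving φ ν ν ∧ ∀ᵐ x ∂ν, c' (φ x) = c x := by
  obtain ⟨f, hf, hfu, ⟨A, hA, hA0, hAi⟩, hfb⟩ := exists_uniform_of_label ν hc
  obtain ⟨g, hg, hgu, ⟨B, hB, hB0, hBi⟩, hgb⟩ := exists_uniform_of_label ν hc'
  obtain ⟨φ, hφ, hφ'⟩ :=
    exists_measurePreserving_comp_ae_eq ν hf hg (hfu.trans hgu.symm) hA hB hA0 hB0 hAi hBi
  refine ⟨φ, hφ, ?_⟩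
  set s : ℕ → ℝ := fun n => ν.real {y | c y < n} with hs
  have hs' : ∀ n, ν.real {y | c' y < n} = s n := by
    intro n
    have h1 := congrArg (fun m : Measure ℕ => m.real (Iio n)) h
    simp only [measureReal_def, Measure.map_apply hc measurableSet_Iio,
      Measure.map_apply hc' measurableSet_Iio] at h1
    exact h1.symm
  have hmono : Monotone s := fun m n hmn => measureReal_mono fun y hy => lt_of_lt_of_le hy hmn
  -- The intervals `[s n, s (n + 1)]` overlap only at breakpoints, which the uniformly distributed
  -- `f` almost surely avoids; off them the value `f x` determines the label.
  have hnull : ∀ᵐ x ∂ν, f x ∉ range s := by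
    have h0 : (ν.map f) (range s) = 0 := by
      rw [hfu]
      exact (countable_range s).measure_zero _
    rw [Measure.map_apply hf (countable_range s).measurableSet] at h0
    exact measure_eq_zero_iff_ae_notMem.1 h0
  filter_upwards [hφ', hnull] with x hx hxs
  have h1 := hfb x
  have h2 := hgb (φ x)
  rw [hx, hs', hs'] at h2
  have hlt : ∀ {m n : ℕ}, s m ≤ f x → f x ≤ s (n + 1) → m ≤ n := by
    intro m n hm hn
    by_contra! hmn
    exact hxs ⟨m, le_antisymm hm (hn.trans (hmono hmn))⟩
  exact le_antisymm (hlt h2.1 h1.2) (hlt h1.1 h2.2)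

end Labels

/-! ### Densities of functionals on `L¹`, via `L²` -/

section Riesz

variable {α : Type*} [MeasurableSpace α] {μ : Measure α} [IsProbabilityMeasure μ]

/-- The inclusion of `L²` into `L¹` over a probability space. -/
def Lp.twoToOne (μ : Measure α) [IsProbabilityMeasure μ] : Lp ℝ 2 μ →L[ℝ] Lp ℝ 1 μ :=
  LinearMap.mkContinuous
    { toFun := fun f => ((Lp.memLp f).mono_exponent one_le_two).toLp f
      map_add' := fun f g => by
        rw [← MemLp.toLp_add]
        exact MemLp.toLp_congr _ _ (Lp.coeFn_add f g)
      map_smul' := fun c f => by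
        rw [RingHom.id_apply, ← MemLp.toLp_const_smul]
        exact MemLp.toLp_congr _ _ (Lp.coeFn_smul c f) }
    1 (fun f => by
      rw [one_mul, LinearMap.coe_mk, AddHom.coe_mk, Lp.norm_toLp, Lp.norm_def]
      exact ENNReal.toReal_mono (Lp.eLpNorm_ne_top f)
        (eLpNorm_le_eLpNorm_of_exponent_le one_le_two (Lp.aestronglyMeasurable f)))

lemma Lp.twoToOne_indicatorConstLp {S : Set α} (hS : MeasurableSet S) :
    Lp.twoToOne μ (indicatorConstLp 2 hS (measure_ne_top μ S) 1) =
      indicatorConstLp 1 hS (measure_ne_top μ S) 1 :=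
  MemLp.toLp_congr ((Lp.memLp _).mono_exponent one_le_two) _ indicatorConstLp_coeFn

/-- A bounded functional on `L¹` of a probability space has an `L²` density. -/
lemma exists_setIntegral_eq_of_continuousLinearMap (L : Lp ℝ 1 μ →L[ℝ] ℝ) :
    ∃ g : Lp ℝ 2 μ, ∀ S (hS : MeasurableSet S),
      ∫ x in S, g x ∂μ = L (indicatorConstLp 1 hS (measure_ne_top μ S) 1) := by
  refine ⟨(InnerProductSpace.toDual ℝ (Lp ℝ 2 μ)).symm (L.comp (Lp.twoToOne μ)), fun S hS => ?_⟩
  rw [← L2.inner_indicatorConstLp_one hS (measure_ne_top μ S), real_inner_comm,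
    InnerProductSpace.toDual_symm_apply, ContinuousLinearMap.comp_apply,
    Lp.twoToOne_indicatorConstLp]

end Riesz

/-! ### Weak* compactness of the space of graphons -/

namespace Graphon

variable {Ω : Type*} [MeasurableSpace Ω] {ν : Measure Ω}

lemma abs_le_one (U : Graphon ν) : ∀ᵐ p ∂(ν.prod ν), ‖U.toAEEqFun p‖ ≤ 1 := by
  filter_upwards [U.mem_Icc] with p hp
  rw [Real.norm_eq_abs, abs_le]
  exact ⟨by linarith [hp.1], hp.2⟩

lemma integrable_mul (U : Graphon ν) {f : Ω × Ω → ℝ} (hf : Integrable f (ν.prod ν)) :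
    Integrable (fun p => f p * U.toAEEqFun p) (ν.prod ν) :=
  hf.mul_bdd U.toAEEqFun.aestronglyMeasurable U.abs_le_one

lemma setIntegral_nonneg (U : Graphon ν) (S : Set (Ω × Ω)) :
    0 ≤ ∫ p in S, U.toAEEqFun p ∂(ν.prod ν) :=
  integral_nonneg_of_ae (ae_restrict_of_ae (U.mem_Icc.mono fun _ h => h.1))

lemma abs_integral_mul_le (U : Graphon ν) (f : Lp ℝ 1 (ν.prod ν)) :
    |∫ p, f p * U.toAEEqFun p ∂(ν.prod ν)| ≤ ‖f‖ := by
  rw [L1.norm_eq_integral_norm]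
  refine norm_integral_le_of_norm_le (f := fun p => f p * U.toAEEqFun p)
    (L1.integrable_coeFn f).norm ?_
  filter_upwards [U.abs_le_one] with p hp
  rw [norm_mul]
  exact mul_le_of_le_one_right (norm_nonneg _) hp

/-- The functional on `L¹` given by integration against a graphon. -/
def toFunctional (U : Graphon ν) : Lp ℝ 1 (ν.prod ν) →L[ℝ] ℝ :=
  LinearMap.mkContinuous
    { toFun := fun f => ∫ p, f p * U.toAEEqFun p ∂(ν.prod ν)
      map_add' := fun f g => by
        rw [← integral_add (U.integrable_mul (L1.integrable_coeFn f))
          (U.integrable_mul (L1.integrable_coeFn g))]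
        refine integral_congr_ae ?_
        filter_upwards [Lp.coeFn_add f g] with p hp
        rw [hp, Pi.add_apply, add_mul]
      map_smul' := fun c f => by
        rw [RingHom.id_apply, smul_eq_mul, ← integral_const_mul]
        refine integral_congr_ae ?_
        filter_upwards [Lp.coeFn_smul c f] with p hp
        rw [hp, Pi.smul_apply, smul_eq_mul, mul_assoc] }
    1 (fun f => by rw [one_mul]; exact U.abs_integral_mul_le f)

lemma continuous_toFunctional_apply (f : Lp ℝ 1 (ν.prod ν)) :
    Continuous fun U : Graphon ν => U.toFunctional f :=
  (continuous_apply f).comp continuous_induced_dom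

lemma isInducing_toFunctional :
    IsInducing fun (U : Graphon ν) (f : Lp ℝ 1 (ν.prod ν)) => U.toFunctional f :=
  ⟨rfl⟩

variable [IsProbabilityMeasure ν]

lemma integrable (U : Graphon ν) : Integrable U.toAEEqFun (ν.prod ν) :=
  Integrable.of_bound U.toAEEqFun.aestronglyMeasurable 1 U.abs_le_one

lemma toFunctional_indicatorConstLp (U : Graphon ν) {S : Set (Ω × Ω)} (hS : MeasurableSet S) :
    U.toFunctional (indicatorConstLp 1 hS (measure_ne_top _ S) 1) =
      ∫ p in S, U.toAEEqFun p ∂(ν.prod ν) := by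
  rw [← integral_indicator hS]
  refine integral_congr_ae ?_
  filter_upwards [indicatorConstLp_coeFn (p := 1) (μ := ν.prod ν) (hs := hS)
    (hμs := measure_ne_top _ S) (c := (1 : ℝ))] with p hp
  rw [hp]
  by_cases h : p ∈ S <;> simp [h]

lemma continuous_setIntegral {S : Set (Ω × Ω)} (hS : MeasurableSet S) :
    Continuous fun U : Graphon ν => ∫ p in S, U.toAEEqFun p ∂(ν.prod ν) := by
  simp_rw [← toFunctional_indicatorConstLp _ hS]
  exact continuous_toFunctional_apply _

lemma setIntegral_le (U : Graphon ν) (S : Set (Ω × Ω)) :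
    ∫ p in S, U.toAEEqFun p ∂(ν.prod ν) ≤ (ν.prod ν).real S := by
  calc ∫ p in S, U.toAEEqFun p ∂(ν.prod ν) ≤ ∫ p in S, (1 : ℝ) ∂(ν.prod ν) :=
        integral_mono_ae U.integrable.integrableOn (integrable_const _)
          (ae_restrict_of_ae (U.mem_Icc.mono fun _ h => h.2))
    _ = (ν.prod ν).real S := by simp

lemma setIntegral_preimage_swap {g : Ω × Ω → ℝ} (S : Set (Ω × Ω)) :
    ∫ p in S, g p.swap ∂(ν.prod ν) = ∫ p in Prod.swap ⁻¹' S, g p ∂(ν.prod ν) := by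
  have h := (Measure.measurePreserving_swap (μ := ν) (ν := ν)).setIntegral_preimage_emb
    MeasurableEquiv.prodComm.measurableEmbedding (fun p => g p.swap) S
  simpa using h.symm

lemma setIntegral_swap (U : Graphon ν) (S : Set (Ω × Ω)) :
    ∫ p in Prod.swap ⁻¹' S, U.toAEEqFun p ∂(ν.prod ν) = ∫ p in S, U.toAEEqFun p ∂(ν.prod ν) := by
  rw [← setIntegral_preimage_swap]
  exact integral_congr_ae (ae_restrict_of_ae U.symm)

/-- A functional on `L¹` with the properties of integration against a graphon is of this form. -/
lemma exists_toFunctional_eq (L : Lp ℝ 1 (ν.prod ν) →L[ℝ] ℝ)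
    (h0 : ∀ S (hS : MeasurableSet S), 0 ≤ L (indicatorConstLp 1 hS (measure_ne_top _ S) 1))
    (h1 : ∀ S (hS : MeasurableSet S),
      L (indicatorConstLp 1 hS (measure_ne_top _ S) 1) ≤ (ν.prod ν).real S)
    (hswap : ∀ S (hS : MeasurableSet S),
      L (indicatorConstLp 1 (measurable_swap hS) (measure_ne_top _ (Prod.swap ⁻¹' S)) 1) =
        L (indicatorConstLp 1 hS (measure_ne_top _ S) 1)) :
    ∃ U : Graphon ν, U.toFunctional = L := by
  obtain ⟨g, hg⟩ := exists_setIntegral_eq_of_continuousLinearMap L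
  have hint : Integrable g (ν.prod ν) := (Lp.memLp g).integrable one_le_two
  have hnonneg : ∀ᵐ p ∂(ν.prod ν), 0 ≤ g p :=
    ae_nonneg_of_forall_setIntegral_nonneg hint fun S hS _ => by rw [hg S hS]; exact h0 S hS
  have hle : ∀ᵐ p ∂(ν.prod ν), g p ≤ 1 :=
    ae_le_of_forall_setIntegral_le hint (integrable_const (1 : ℝ)) fun S hS _ => by
      rw [hg S hS]; simpa using h1 S hS
  have hsymm : ∀ᵐ p ∂(ν.prod ν), g p.swap = g p := by
    refine Integrable.ae_eq_of_forall_setIntegral_eq (g ∘ Prod.swap) g hint.swap hint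
      fun S hS _ => ?_
    simp only [Function.comp_apply]
    rw [setIntegral_preimage_swap, hg S hS, hg _ (measurable_swap hS), hswap]
  let U : Graphon ν :=
    ⟨g.1, by filter_upwards [hnonneg, hle] with p hp hp' using ⟨hp, hp'⟩, hsymm⟩
  refine ⟨U, ?_⟩
  ext f
  -- The density is known to represent `L` only on indicators; linearity and continuity extend this
  -- to `L¹`.
  refine Lp.induction ENNReal.one_ne_top (fun f => U.toFunctional f = L f) ?_ ?_ ?_ f
  · intro c S hS hμS
    have hc : (indicatorConstLp 1 hS hμS.ne c : Lp ℝ 1 (ν.prod ν)) =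
        c • indicatorConstLp 1 hS hμS.ne (1 : ℝ) := by
      refine Lp.ext ?_
      filter_upwards [indicatorConstLp_coeFn (p := 1) (μ := ν.prod ν) (hs := hS) (hμs := hμS.ne)
        (c := c), indicatorConstLp_coeFn (p := 1) (μ := ν.prod ν) (hs := hS) (hμs := hμS.ne)
        (c := (1 : ℝ)), Lp.coeFn_smul c (indicatorConstLp 1 hS hμS.ne (1 : ℝ))] with p h1 h2 h3
      rw [h1, h3, Pi.smul_apply, h2]
      by_cases h : p ∈ S <;> simp [h]
    rw [Lp.simpleFunc.coe_indicatorConst, hc, map_smul, map_smul, toFunctional_indicatorConstLp,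
      ← hg S hS]
  · intro f g hf hg _ hfL hgL
    rw [map_add, map_add, hfL, hgL]
  · exact isClosed_eq U.toFunctional.continuous L.continuous

/-- Linearity, the norm bound, the bounds on indicators and the swap symmetry are closed conditions
on finitely many coordinates each, so they pass to pointwise limits; by `exists_toFunctional_eq`
they characterize graphons. -/
lemma isClosed_range_toFunctional :
    IsClosed (range fun (U : Graphon ν) (f : Lp ℝ 1 (ν.prod ν)) => U.toFunctional f) := by
  rw [← closure_subset_iff_isClosed]
  intro L hL
  have key : ∀ {p : (Lp ℝ 1 (ν.prod ν) → ℝ) → Prop}, IsClosed {L | p L} →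
      (∀ U : Graphon ν, p fun f => U.toFunctional f) → p L := by
    intro p hp h
    exact closure_minimal (range_subset_iff.2 h) hp hL
  let L' : Lp ℝ 1 (ν.prod ν) →L[ℝ] ℝ := LinearMap.mkContinuous
    { toFun := L
      map_add' := fun f g => key
        (isClosed_eq (continuous_apply _) ((continuous_apply _).add (continuous_apply _)))
        fun U => map_add _ _ _
      map_smul' := fun c f => key
        (isClosed_eq (continuous_apply _) ((continuous_apply _).const_smul _))
        fun U => map_smul _ _ _ }
    1 (fun f => by
      rw [one_mul]
      exact key (p := fun L => ‖L f‖ ≤ ‖f‖)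
        (isClosed_le (continuous_apply f).norm continuous_const) fun U => U.abs_integral_mul_le f)
  obtain ⟨U, hU⟩ := exists_toFunctional_eq L'
    (fun S hS => key (isClosed_le continuous_const (continuous_apply _)) fun U => by
      beta_reduce
      rw [toFunctional_indicatorConstLp]; exact U.setIntegral_nonneg S)
    (fun S hS => key (isClosed_le (continuous_apply _) continuous_const) fun U => by
      beta_reduce
      rw [toFunctional_indicatorConstLp]; exact U.setIntegral_le S)
    (fun S hS => key (isClosed_eq (continuous_apply _) (continuous_apply _)) fun U => by
      beta_reduce
      rw [toFunctional_indicatorConstLp, toFunctional_indicatorConstLp]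
      exact U.setIntegral_swap S)
  exact ⟨U, congrArg DFunLike.coe hU⟩

instance : CompactSpace (Graphon ν) := by
  refine ⟨isInducing_toFunctional.isCompact_iff.2 ?_⟩
  rw [image_univ]
  refine IsCompact.of_isClosed_subset
    (isCompact_univ_pi fun f : Lp ℝ 1 (ν.prod ν) => isCompact_Icc (a := -‖f‖) (b := ‖f‖))
    isClosed_range_toFunctional ?_
  rintro _ ⟨U, rfl⟩ f -
  exact abs_le.1 (U.abs_integral_mul_le f)

/-- The integrals over rectangles determine a graphon. -/
lemma ext_of_setIntegral_prod {U W : Graphon ν}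
    (h : ∀ S T, MeasurableSet S → MeasurableSet T →
      ∫ p in S ×ˢ T, U.toAEEqFun p ∂(ν.prod ν) = ∫ p in S ×ˢ T, W.toAEEqFun p ∂(ν.prod ν)) :
    U = W := by
  -- A graphon is viewed as the density of a finite measure on `Ω × Ω`, which is determined by its
  -- values on rectangles.
  have hmeas : ∀ U : Graphon ν, ∀ S, MeasurableSet S →
      ((ν.prod ν).withDensity fun p => ENNReal.ofReal (U.toAEEqFun p)) S =
        ENNReal.ofReal (∫ p in S, U.toAEEqFun p ∂(ν.prod ν)) := by
    intro U S hS
    rw [withDensity_apply _ hS, ofReal_integral_eq_lintegral_ofReal U.integrable.integrableOn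
      (ae_restrict_of_ae (U.mem_Icc.mono fun _ h => h.1))]
  have hfin : ∀ U : Graphon ν, IsFiniteMeasure
      ((ν.prod ν).withDensity fun p => ENNReal.ofReal (U.toAEEqFun p)) :=
    fun U => ⟨by rw [hmeas U _ MeasurableSet.univ]; exact ENNReal.ofReal_lt_top⟩
  have heq : ((ν.prod ν).withDensity fun p => ENNReal.ofReal (U.toAEEqFun p)) =
      (ν.prod ν).withDensity fun p => ENNReal.ofReal (W.toAEEqFun p) := by
    have := hfin U
    refine Measure.ext_prod fun {S T} hS hT => ?_
    rw [hmeas _ _ (hS.prod hT), hmeas _ _ (hS.prod hT), h S T hS hT]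
  refine Graphon.ext (AEEqFun.ext ?_)
  refine Integrable.ae_eq_of_forall_setIntegral_eq _ _ U.integrable W.integrable fun S hS _ => ?_
  have := congrArg (fun m : Measure (Ω × Ω) => m S) heq
  simp only [hmeas _ _ hS] at this
  exact (ENNReal.ofReal_eq_ofReal_iff (U.setIntegral_nonneg S) (W.setIntegral_nonneg S)).1 this

end Graphon

/-! ### Multiway cuts as images of versions -/

namespace Graphon

section Cuts

variable {Ω : Type*} [MeasurableSpace Ω] {ν : Measure Ω}

/-- The set of all versions of a graphon. -/
def versions (W : Graphon ν) : Set (Graphon ν) := {U | IsVersion U W}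

lemma mem_versions_self (W : Graphon ν) : W ∈ versions W :=
  ⟨MeasurableEquiv.refl Ω, MeasurePreserving.id ν, Eventually.of_forall fun _ => rfl⟩

/-- The matrix of integrals of a graphon over the cells of a labelling. -/
def cutMatrix {q : ℕ} (c : Ω → Fin q) (U : Graphon ν) : Matrix (Fin q) (Fin q) ℝ :=
  fun i j => ∫ p in (c ⁻¹' {i}) ×ˢ (c ⁻¹' {j}), U.toAEEqFun p ∂(ν.prod ν)

lemma mem_multiwayCuts_iff {q : ℕ} {a : Fin q → ℝ} {W : Graphon ν}
    {M : Matrix (Fin q) (Fin q) ℝ} :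
    M ∈ multiwayCuts a W ↔ ∃ c : Ω → Fin q, Measurable c ∧ (∀ i, ν.real (c ⁻¹' {i}) = a i) ∧
      cutMatrix c W = M := by
  constructor
  · rintro ⟨P, hP, hdisj, hU, ha, hM⟩
    have hex : ∀ x, ∃ i, x ∈ P i := fun x => mem_iUnion.1 (hU ▸ mem_univ x)
    choose c hc using hex
    have hcP : ∀ i, c ⁻¹' {i} = P i := by
      intro i
      ext x
      constructor
      · rintro rfl
        exact hc x
      · intro hx
        by_contra hne
        exact (Set.disjoint_left.1 (hdisj _ _ hne)) (hc x) hx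
    refine ⟨c, measurable_to_countable' fun i => hcP i ▸ hP i, fun i => by rw [hcP, ha], ?_⟩
    ext i j
    rw [hM, cutMatrix, hcP, hcP]
  · rintro ⟨c, hc, ha, rfl⟩
    refine ⟨fun i => c ⁻¹' {i}, fun i => hc (measurableSet_singleton i), fun i j hij => ?_, ?_, ha,
      fun i j => rfl⟩
    · exact Disjoint.preimage _ (disjoint_singleton.2 hij)
    · ext x
      simp

variable [IsProbabilityMeasure ν]

/-- The version of a graphon given by a measure preserving bijection. -/
def comap (W : Graphon ν) (φ : Ω ≃ᵐ Ω) (hφ : MeasurePreserving φ ν ν) : Graphon ν where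
  toAEEqFun := W.toAEEqFun.compMeasurePreserving (Prod.map φ φ) (hφ.prod hφ)
  mem_Icc := by
    filter_upwards [W.toAEEqFun.coeFn_compMeasurePreserving (hφ.prod hφ),
      (hφ.prod hφ).quasiMeasurePreserving.ae W.mem_Icc] with p h1 h2
    rw [h1]
    exact h2
  symm := by
    have h := W.toAEEqFun.coeFn_compMeasurePreserving (hφ.prod hφ)
    filter_upwards [h,
      (Measure.measurePreserving_swap (μ := ν) (ν := ν)).quasiMeasurePreserving.ae h,
      (hφ.prod hφ).quasiMeasurePreserving.ae W.symm] with p h1 h2 h3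
    rw [h1, h2]
    exact h3

lemma comap_mem_versions (W : Graphon ν) (φ : Ω ≃ᵐ Ω) (hφ : MeasurePreserving φ ν ν) :
    W.comap φ hφ ∈ versions W :=
  ⟨φ, hφ, W.toAEEqFun.coeFn_compMeasurePreserving (hφ.prod hφ)⟩

lemma setIntegral_preimage_of_ae_eq {U W : Graphon ν} {φ : Ω ≃ᵐ Ω} (hφ : MeasurePreserving φ ν ν)
    (h : ∀ᵐ p ∂(ν.prod ν), U.toAEEqFun p = W.toAEEqFun (φ p.1, φ p.2)) (S T : Set Ω) :
    ∫ p in (φ ⁻¹' S) ×ˢ (φ ⁻¹' T), U.toAEEqFun p ∂(ν.prod ν) =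
      ∫ p in S ×ˢ T, W.toAEEqFun p ∂(ν.prod ν) := by
  rw [← (hφ.prod hφ).setIntegral_preimage_emb (φ.prodCongr φ).measurableEmbedding
    W.toAEEqFun (S ×ˢ T)]
  exact integral_congr_ae (ae_restrict_of_ae h)

lemma cutMatrix_of_ae_eq {U W : Graphon ν} {φ : Ω ≃ᵐ Ω} (hφ : MeasurePreserving φ ν ν)
    (h : ∀ᵐ p ∂(ν.prod ν), U.toAEEqFun p = W.toAEEqFun (φ p.1, φ p.2)) {q : ℕ}
    {c c' : Ω → Fin q} (hc : ∀ᵐ x ∂ν, c' (φ x) = c x) : cutMatrix c U = cutMatrix c' W := by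
  ext i j
  rw [cutMatrix, cutMatrix, ← setIntegral_preimage_of_ae_eq hφ h]
  have hcell : ∀ k, (c ⁻¹' {k} : Set Ω) =ᵐ[ν] φ ⁻¹' (c' ⁻¹' {k}) := fun k =>
    hc.mono fun x hx => by
      refine propext ?_
      change c x = k ↔ c' (φ x) = k
      rw [hx]
  exact setIntegral_congr_set (Measure.set_prod_ae_eq (hcell i) (hcell j))

/-- If one labelling with cells of the given sizes is fixed, all the multiway cuts are obtained from
the versions of the graphon. -/
lemma multiwayCuts_eq_image [StandardBorelSpace Ω] [NullSingletonClass ν] {q : ℕ} {a : Fin q → ℝ}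
    {c : Ω → Fin q} (hc : Measurable c) (ha : ∀ i, ν.real (c ⁻¹' {i}) = a i) (W : Graphon ν) :
    multiwayCuts a W = cutMatrix c '' versions W := by
  ext M
  rw [mem_multiwayCuts_iff]
  constructor
  · rintro ⟨c', hc', ha', rfl⟩
    -- Equal cell sizes mean equal laws, so `c' ∘ φ = c` almost everywhere for some `φ`, and cutting
    -- `W` along `c'` is cutting its version by `φ` along `c`.
    have hlaw : ν.map c = ν.map c' := by
      refine Measure.ext_of_singleton fun i => ?_
      rw [Measure.map_apply hc (measurableSet_singleton i),
        Measure.map_apply hc' (measurableSet_singleton i), ← ofReal_measureReal,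
        ← ofReal_measureReal, ha, ha']
    have hval : Measurable (Fin.val : Fin q → ℕ) := measurable_of_countable _
    obtain ⟨φ, hφ, hφc⟩ := exists_measurePreserving_label_comp ν (hval.comp hc) (hval.comp hc')
      (by rw [← Measure.map_map hval hc, ← Measure.map_map hval hc', hlaw])
    refine ⟨W.comap φ hφ, W.comap_mem_versions φ hφ, ?_⟩
    exact cutMatrix_of_ae_eq (U := W.comap φ hφ) hφ
      (W.toAEEqFun.coeFn_compMeasurePreserving (hφ.prod hφ))
      (hφc.mono fun x hx => Fin.ext hx)
  · rintro ⟨U, ⟨φ, hφ, hU⟩, rfl⟩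
    refine ⟨c ∘ φ.symm, hc.comp φ.symm.measurable, fun i => ?_, ?_⟩
    · rw [← ha, preimage_comp]
      exact (hφ.symm φ).measureReal_preimage (hc (measurableSet_singleton i)).nullMeasurableSet
    · exact (cutMatrix_of_ae_eq hφ hU (Eventually.of_forall fun x => by simp)).symm

lemma continuous_cutMatrix_apply {q : ℕ} {c : Ω → Fin q} (hc : Measurable c) (i j : Fin q) :
    Continuous fun U : Graphon ν => cutMatrix c U i j :=
  continuous_setIntegral
    ((hc (measurableSet_singleton i)).prod (hc (measurableSet_singleton j)))

lemma continuous_matrixL1Dist_cutMatrix {q : ℕ} {c : Ω → Fin q} (hc : Measurable c) :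
    Continuous fun p : Graphon ν × Graphon ν =>
      matrixL1Dist (cutMatrix c p.1) (cutMatrix c p.2) :=
  continuous_finsetSum _ fun i _ => continuous_finsetSum _ fun j _ =>
    (((continuous_cutMatrix_apply hc i j).comp continuous_fst).sub
      ((continuous_cutMatrix_apply hc i j).comp continuous_snd)).abs

lemma cutMatrix_mem_Icc {q : ℕ} (c : Ω → Fin q) (U : Graphon ν) (i j : Fin q) :
    cutMatrix c U i j ∈ Icc (0 : ℝ) 1 :=
  ⟨U.setIntegral_nonneg _, (U.setIntegral_le _).trans measureReal_le_one⟩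

lemma matrixL1Dist_le_of_mem_multiwayCuts {q : ℕ} {a : Fin q → ℝ} {U W : Graphon ν}
    {M N : Matrix (Fin q) (Fin q) ℝ} (hM : M ∈ multiwayCuts a U) (hN : N ∈ multiwayCuts a W) :
    matrixL1Dist M N ≤ ∑ _i : Fin q, ∑ _j : Fin q, (1 : ℝ) := by
  obtain ⟨c, -, -, rfl⟩ := mem_multiwayCuts_iff.1 hM
  obtain ⟨c', -, -, rfl⟩ := mem_multiwayCuts_iff.1 hN
  refine Finset.sum_le_sum fun i _ => Finset.sum_le_sum fun j _ => ?_
  have h1 := cutMatrix_mem_Icc c U i j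
  have h2 := cutMatrix_mem_Icc c' W i j
  rw [abs_le]
  exact ⟨by linarith [h1.1, h2.2], by linarith [h1.2, h2.1]⟩

lemma setIntegral_preimage_eq_sum_cutMatrix {q : ℕ} {c : Ω → Fin q} (hc : Measurable c)
    (U : Graphon ν) (I J : Finset (Fin q)) :
    ∫ p in (c ⁻¹' I) ×ˢ (c ⁻¹' J), U.toAEEqFun p ∂(ν.prod ν) =
      ∑ i ∈ I, ∑ j ∈ J, cutMatrix c U i j := by
  refine Eq.trans ?_ (Finset.sum_product' I J fun i j => cutMatrix c U i j)
  have hset : (c ⁻¹' I) ×ˢ (c ⁻¹' J) =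
      ⋃ k ∈ I ×ˢ J, ((c ⁻¹' {k.1}) ×ˢ (c ⁻¹' {k.2}) : Set (Ω × Ω)) := by
    ext p
    simp only [mem_prod, mem_preimage, Finset.mem_coe, mem_iUnion, mem_singleton_iff,
      Finset.mem_product, exists_prop, Prod.exists]
    constructor
    · rintro h
      exact ⟨_, _, h, rfl, rfl⟩
    · rintro ⟨i, j, h, hi, hj⟩
      exact hi ▸ hj ▸ h
  rw [hset]
  refine integral_biUnion_finset _
    (fun k _ => (hc (measurableSet_singleton _)).prod (hc (measurableSet_singleton _))) ?_
    (fun k _ => U.integrable.integrableOn)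
  intro k _ l _ hkl
  refine Set.disjoint_left.2 fun p hp hp' => hkl ?_
  exact Prod.ext (hp.1.symm.trans hp'.1) (hp.2.symm.trans hp'.2)

lemma abs_setIntegral_sub_le_matrixL1Dist {q : ℕ} {c : Ω → Fin q} (hc : Measurable c)
    (U W : Graphon ν) (I J : Finset (Fin q)) :
    |∫ p in (c ⁻¹' I) ×ˢ (c ⁻¹' J), U.toAEEqFun p ∂(ν.prod ν) -
      ∫ p in (c ⁻¹' I) ×ˢ (c ⁻¹' J), W.toAEEqFun p ∂(ν.prod ν)| ≤
      matrixL1Dist (cutMatrix c U) (cutMatrix c W) := by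
  rw [setIntegral_preimage_eq_sum_cutMatrix hc, setIntegral_preimage_eq_sum_cutMatrix hc,
    ← Finset.sum_sub_distrib]
  simp_rw [← Finset.sum_sub_distrib]
  calc |∑ i ∈ I, ∑ j ∈ J, (cutMatrix c U i j - cutMatrix c W i j)|
      ≤ ∑ i ∈ I, ∑ j ∈ J, |cutMatrix c U i j - cutMatrix c W i j| :=
        (Finset.abs_sum_le_sum_abs _ _).trans
          (Finset.sum_le_sum fun i _ => Finset.abs_sum_le_sum_abs _ _)
    _ ≤ ∑ i ∈ I, ∑ j, |cutMatrix c U i j - cutMatrix c W i j| :=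
        Finset.sum_le_sum fun i _ =>
          Finset.sum_le_univ_sum_of_nonneg fun j => abs_nonneg _
    _ ≤ ∑ i, ∑ j, |cutMatrix c U i j - cutMatrix c W i j| :=
        Finset.sum_le_univ_sum_of_nonneg fun i => Finset.sum_nonneg fun j _ => abs_nonneg _

end Cuts

/-- Finitely many measurable sets are unions of cells of one finite labelling. -/
lemma _root_.exists_label_of_finite {Ω ι : Type*} [MeasurableSpace Ω] [Finite ι] {S : ι → Set Ω}
    (hS : ∀ i, MeasurableSet (S i)) :
    ∃ (q : ℕ) (c : Ω → Fin q), Measurable c ∧ ∀ i, ∃ I : Finset (Fin q), S i = c ⁻¹' I := by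
  classical
  have := Fintype.ofFinite ι
  -- Points are labelled by the list of sets containing them.
  let b : Ω → ι → Bool := fun x i => decide (x ∈ S i)
  have hb : Measurable b := measurable_pi_lambda _ fun i =>
    measurable_to_bool (by
      have : (fun x => decide (x ∈ S i)) ⁻¹' {true} = S i := by ext x; simp
      rw [this]; exact hS i)
  let e := Fintype.equivFin (ι → Bool)
  refine ⟨_, e ∘ b, (measurable_of_countable e).comp hb, fun i =>
    ⟨Finset.univ.filter fun k => e.symm k i = true, ?_⟩⟩
  ext x
  simp [b]

end Graphon

lemma matrixL1Dist_nonneg {q : ℕ} (M N : Matrix (Fin q) (Fin q) ℝ) : 0 ≤ matrixL1Dist M N :=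
  Finset.sum_nonneg fun _ _ => Finset.sum_nonneg fun _ _ => abs_nonneg _

lemma matrixL1Dist_self {q : ℕ} (M : Matrix (Fin q) (Fin q) ℝ) : matrixL1Dist M M = 0 := by
  simp [matrixL1Dist]

/-! ### Comparing weak* distance with cut matrices -/

namespace Graphon

variable {Ω : Type*} [MeasurableSpace Ω] {ν : Measure Ω}

lemma envelope_eq_closure [FirstCountableTopology (Graphon ν)] (W : Graphon ν) :
    envelope W = closure (versions W) := by
  ext U
  exact (mem_closure_iff_seq_limit (s := versions W)).symm

variable [IsProbabilityMeasure ν]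

section Metric

variable {m : MetricSpace (Graphon ν)}
  (hm : m.toPseudoMetricSpace.toUniformSpace.toTopologicalSpace = weakStarTopology ν)

include hm

lemma exists_matrixL1Dist_lt {q : ℕ} {c : Ω → Fin q} (hc : Measurable c) {ε : ℝ} (hε : 0 < ε) :
    ∃ δ > 0, ∀ U W : Graphon ν, m.dist U W < δ →
      matrixL1Dist (cutMatrix c U) (cutMatrix c W) < ε := by
  -- The metric is kept, but its topology becomes definitionally the weak* one, so that the
  -- compactness instance applies.
  let _ : MetricSpace (Graphon ν) := m.replaceTopology hm.symm
  have huc := CompactSpace.uniformContinuous_of_continuous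
    (continuous_matrixL1Dist_cutMatrix (ν := ν) hc)
  obtain ⟨δ, hδ, h⟩ := Metric.uniformContinuous_iff.1 huc ε hε
  refine ⟨δ, hδ, fun U W hUW => ?_⟩
  -- Uniform continuity is used against the diagonal, where the matrix distance vanishes.
  have hd : dist (U, W) (W, W) < δ := by
    rw [Prod.dist_eq, dist_self, max_lt_iff]
    exact ⟨hUW, hδ⟩
  have := h hd
  rw [Real.dist_eq] at this
  simp only [matrixL1Dist_self, sub_zero] at this
  exact (le_abs_self _).trans_lt this

/-- The pairs at distance at least `ε` form a compact set, and each is separated by some rectangle.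
Finitely many rectangles suffice, with total discrepancy at least some `η > 0`; a labelling refining
all their sides bounds each discrepancy by the matrix distance. -/
lemma exists_label_dist_lt {ε : ℝ} (hε : 0 < ε) :
    ∃ (q : ℕ) (c : Ω → Fin q), Measurable c ∧ ∃ δ > 0, ∀ U W : Graphon ν,
      matrixL1Dist (cutMatrix c U) (cutMatrix c W) < δ → m.dist U W < ε := by
  let _ : MetricSpace (Graphon ν) := m.replaceTopology hm.symm
  set K : Set (Graphon ν × Graphon ν) := {p | ε ≤ dist p.1 p.2} with hK
  have hKc : IsCompact K := (isClosed_le continuous_const continuous_dist).isCompact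
  let ι := {S : Set Ω // MeasurableSet S} × {S : Set Ω // MeasurableSet S}
  let F : ι → Graphon ν × Graphon ν → ℝ := fun s p =>
    |∫ x in (s.1 : Set Ω) ×ˢ (s.2 : Set Ω), p.1.toAEEqFun x ∂(ν.prod ν) -
      ∫ x in (s.1 : Set Ω) ×ˢ (s.2 : Set Ω), p.2.toAEEqFun x ∂(ν.prod ν)|
  have hF : ∀ s, Continuous (F s) := fun s =>
    (((continuous_setIntegral (s.1.2.prod s.2.2)).comp continuous_fst).sub
      ((continuous_setIntegral (s.1.2.prod s.2.2)).comp continuous_snd)).abs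
  obtain ⟨t, ht⟩ := hKc.elim_finite_subcover (fun s => {p | 0 < F s p})
    (fun s => isOpen_lt continuous_const (hF s)) (by
      intro p hp
      by_contra hcon
      simp only [mem_iUnion, mem_ofPred_eq, not_exists, not_lt] at hcon
      have heq : p.1 = p.2 := ext_of_setIntegral_prod fun S T hS hT =>
        sub_eq_zero.1 (abs_nonpos_iff.1 (hcon (⟨S, hS⟩, ⟨T, hT⟩)))
      have hp' : ε ≤ dist p.1 p.2 := hp
      rw [heq, dist_self] at hp'
      exact absurd hp' (not_le.2 hε))
  obtain ⟨η, hη, hηK⟩ := hKc.exists_forall_le' (f := fun p => ∑ s ∈ t, F s p) (a := 0)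
    (continuous_finsetSum _ fun s _ => hF s).continuousOn (by
      intro p hp
      obtain ⟨s, hs, hsp⟩ := mem_iUnion₂.1 (ht hp)
      exact Finset.sum_pos' (fun _ _ => abs_nonneg _) ⟨s, hs, hsp⟩)
  obtain ⟨q, c, hc, hcS⟩ := exists_label_of_finite
    (S := fun i : t ⊕ t => i.elim (fun s => (s.1.1 : Set Ω)) (fun s => (s.1.2 : Set Ω))) (by
      rintro (s | s)
      · exact s.1.1.2
      · exact s.1.2.2)
  -- The summand `1` keeps the denominator positive when `t` is empty.
  refine ⟨q, c, hc, η / (t.card + 1), by positivity, fun U W hUW => ?_⟩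
  by_contra hcon
  have hmem : (U, W) ∈ K := not_lt.1 hcon
  have h1 : ∀ s ∈ t, F s (U, W) ≤ matrixL1Dist (cutMatrix c U) (cutMatrix c W) := by
    intro s hs
    obtain ⟨I, hI⟩ := hcS (Sum.inl ⟨s, hs⟩)
    obtain ⟨J, hJ⟩ := hcS (Sum.inr ⟨s, hs⟩)
    simp only [Sum.elim_inl] at hI
    simp only [Sum.elim_inr] at hJ
    simp only [F, hI, hJ]
    exact abs_setIntegral_sub_le_matrixL1Dist hc U W I J
  have h2 : η ≤ t.card * matrixL1Dist (cutMatrix c U) (cutMatrix c W) := by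
    refine (hηK _ hmem).trans ((Finset.sum_le_sum h1).trans ?_)
    rw [Finset.sum_const, nsmul_eq_mul]
  rw [lt_div_iff₀ (by positivity)] at hUW
  nlinarith [matrixL1Dist_nonneg (cutMatrix c U) (cutMatrix c W)]

lemma LIM_eq_ACC_iff (Γ : ℕ → Graphon ν) :
    LIM Γ = ACC Γ ↔ IsMutuallyClose m.dist fun n => versions (Γ n) := by
  let _ : MetricSpace (Graphon ν) := m.replaceTopology hm.symm
  exact lower_limit_eq_upper_limit_iff fun n => ⟨_, mem_versions_self (Γ n)⟩

lemma isCauchyFor_envelope_iff (Γ : ℕ → Graphon ν) :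
    IsCauchyFor (hausdorffDistOf m.dist) (fun n => envelope (Γ n)) ↔
      IsMutuallyClose m.dist fun n => versions (Γ n) := by
  let _ : MetricSpace (Graphon ν) := m.replaceTopology hm.symm
  have hne : ∀ n, (envelope (Γ n)).Nonempty := fun n => by
    rw [envelope_eq_closure]
    exact ⟨_, subset_closure (mem_versions_self (Γ n))⟩
  obtain ⟨C, hC⟩ := Metric.isBounded_iff.1 (isCompact_univ (X := Graphon ν)).isBounded
  refine (isCauchyFor_hausdorffDistOf_iff (C := C) (fun U W => dist_nonneg)
    (fun _ _ U _ W _ => hC (mem_univ U) (mem_univ W)) hne).trans ?_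
  simp_rw [envelope_eq_closure]
  exact isMutuallyClose_closure_iff

lemma isMutuallyClose_versions_iff [StandardBorelSpace Ω] [NullSingletonClass ν]
    (Γ : ℕ → Graphon ν) :
    (IsMutuallyClose m.dist fun n => versions (Γ n)) ↔
      ∀ (q : ℕ) (a : Fin q → ℝ), (∀ i, 0 ≤ a i) → ∑ i, a i = 1 →
        IsCauchyFor (hausdorffDistOf matrixL1Dist) (fun n => multiwayCuts a (Γ n)) := by
  have hiff : ∀ {q : ℕ} {a : Fin q → ℝ} {c : Ω → Fin q}, Measurable c →
      (∀ i, ν.real (c ⁻¹' {i}) = a i) →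
      (IsCauchyFor (hausdorffDistOf matrixL1Dist) (fun n => multiwayCuts a (Γ n)) ↔
        IsMutuallyClose matrixL1Dist fun n => cutMatrix c '' versions (Γ n)) := by
    intro q a c hc ha
    rw [isCauchyFor_hausdorffDistOf_iff matrixL1Dist_nonneg
      (fun _ _ _ hM _ hN => matrixL1Dist_le_of_mem_multiwayCuts hM hN) (fun n =>
        ⟨_, mem_multiwayCuts_iff.2 ⟨c, hc, ha, rfl⟩⟩)]
    simp_rw [multiwayCuts_eq_image hc ha]
  constructor
  · intro h q a _ _
    by_cases hex : ∃ c : Ω → Fin q, Measurable c ∧ ∀ i, ν.real (c ⁻¹' {i}) = a i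
    · obtain ⟨c, hc, ha⟩ := hex
      rw [hiff hc ha]
      intro ε hε
      obtain ⟨δ, hδ, hδε⟩ := exists_matrixL1Dist_lt hm hc hε
      obtain ⟨N, hN⟩ := h δ hδ
      refine ⟨N, fun k n hk hn => ?_⟩
      rintro _ ⟨U, hU, rfl⟩
      obtain ⟨W, hW, hUW⟩ := hN k n hk hn U hU
      exact ⟨_, ⟨W, hW, rfl⟩, hδε U W hUW⟩
    -- If no labelling has these cell sizes, all the sets of cuts are empty, so the existence of
    -- partitions with prescribed sizes is not needed.
    · refine isCauchyFor_hausdorffDistOf_of_isEmpty fun n => ?_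
      rw [eq_empty_iff_forall_notMem]
      intro M hM
      obtain ⟨c, hc, ha, -⟩ := mem_multiwayCuts_iff.1 hM
      exact hex ⟨c, hc, ha⟩
  · intro h ε hε
    obtain ⟨q, c, hc, δ, hδ, hδε⟩ := exists_label_dist_lt hm hε
    have hsum : ∑ i, ν.real (c ⁻¹' {i}) = 1 := by
      rw [sum_measureReal_preimage_singleton _ fun i _ => hc (measurableSet_singleton i)]
      simp
    obtain ⟨N, hN⟩ := (hiff hc fun _ => rfl).1 (h q _ (fun _ => measureReal_nonneg) hsum) δ hδ
    refine ⟨N, fun k n hk hn U hU => ?_⟩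
    obtain ⟨_, ⟨W, hW, rfl⟩, hUW⟩ := hN k n hk hn _ ⟨U, hU, rfl⟩
    exact ⟨W, hW, hδε U W hUW⟩

end Metric

lemma tfae_of_isWeakStarMetric [StandardBorelSpace Ω] [NullSingletonClass ν]
    (Γ : ℕ → Graphon ν) {d : Graphon ν → Graphon ν → ℝ} (hd : IsWeakStarMetric d) :
    List.TFAE [
      LIM Γ = ACC Γ,
      IsCauchyFor (hausdorffDistOf d) (fun n => envelope (Γ n)),
      ∀ (q : ℕ) (a : Fin q → ℝ), (∀ i, 0 ≤ a i) → ∑ i, a i = 1 →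
        IsCauchyFor (hausdorffDistOf matrixL1Dist) (fun n => multiwayCuts a (Γ n))] := by
  obtain ⟨m, hm, hdm⟩ := hd
  obtain rfl : d = m.dist := funext fun U => funext fun W => hdm U W
  tfae_have 1 ↔ 2 := (LIM_eq_ACC_iff hm Γ).trans (isCauchyFor_envelope_iff hm Γ).symm
  tfae_have 2 ↔ 3 := (isCauchyFor_envelope_iff hm Γ).trans (isMutuallyClose_versions_iff hm Γ)
  tfae_finish

/-- A continuous injection from a compact space to a Hausdorff space is a closed embedding. It is
used for the identity between two topologies on graphons. -/
lemma _root_.eq_induced_of_continuous_dist {X Y : Type*} [t : TopologicalSpace X]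
    [CompactSpace X] [MetricSpace Y] {f : X → Y} (hinj : Function.Injective f)
    (h : ∀ y : X, Continuous fun x => dist (f x) (f y)) :
    t = TopologicalSpace.induced f inferInstance := by
  have hf : Continuous f := continuous_iff_continuousAt.2 fun y => by
    rw [ContinuousAt, tendsto_iff_dist_tendsto_zero]
    simpa using (h y).tendsto y
  exact (hf.isClosedEmbedding hinj).isInducing.eq_induced

/-! ### The explicit distance metrizes the weak* topology -/

section WeakStarDist

variable {A : ℕ → Set Ω}

/-- The difference of the integrals of two graphons over a rectangle `A n ×ˢ A k`. -/
def rectDiff (A : ℕ → Set Ω) (U W : Graphon ν) (nk : ℕ × ℕ) : ℝ :=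
  ∫ p in A nk.1 ×ˢ A nk.2, U.toAEEqFun p ∂(ν.prod ν) -
    ∫ p in A nk.1 ×ˢ A nk.2, W.toAEEqFun p ∂(ν.prod ν)

lemma weakStarDist_eq (A : ℕ → Set Ω) (U W : Graphon ν) :
    weakStarDist A U W =
      ∑' nk : ℕ × ℕ, ((2 : ℝ) ^ (nk.1 + nk.2))⁻¹ * |rectDiff A U W nk| := by
  refine tsum_congr fun nk => ?_
  rw [integral_sub U.integrable.integrableOn W.integrable.integrableOn, rectDiff]

lemma abs_rectDiff_le (A : ℕ → Set Ω) (U W : Graphon ν) (nk : ℕ × ℕ) :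
    |rectDiff A U W nk| ≤ 1 := by
  have h1 := U.setIntegral_nonneg (A nk.1 ×ˢ A nk.2)
  have h2 := W.setIntegral_nonneg (A nk.1 ×ˢ A nk.2)
  have h3 := (U.setIntegral_le (A nk.1 ×ˢ A nk.2)).trans measureReal_le_one
  have h4 := (W.setIntegral_le (A nk.1 ×ˢ A nk.2)).trans measureReal_le_one
  rw [rectDiff, abs_le]
  constructor <;> linarith

lemma summable_weights : Summable fun nk : ℕ × ℕ => ((2 : ℝ) ^ (nk.1 + nk.2))⁻¹ := by
  have h : Summable fun n : ℕ => ((2 : ℝ) ^ n)⁻¹ := by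
    simpa [one_div, inv_pow] using summable_geometric_two
  refine (h.mul_of_nonneg h (fun n => by positivity) (fun n => by positivity)).congr fun nk => ?_
  rw [pow_add, mul_inv]

lemma weight_mul_abs_rectDiff_le (A : ℕ → Set Ω) (U W : Graphon ν) (nk : ℕ × ℕ) :
    ‖((2 : ℝ) ^ (nk.1 + nk.2))⁻¹ * |rectDiff A U W nk|‖ ≤ ((2 : ℝ) ^ (nk.1 + nk.2))⁻¹ := by
  rw [Real.norm_of_nonneg (by positivity)]
  exact mul_le_of_le_one_right (by positivity) (abs_rectDiff_le A U W nk)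

lemma summable_weakStarDist (A : ℕ → Set Ω) (U W : Graphon ν) :
    Summable fun nk : ℕ × ℕ => ((2 : ℝ) ^ (nk.1 + nk.2))⁻¹ * |rectDiff A U W nk| :=
  Summable.of_norm_bounded summable_weights (weight_mul_abs_rectDiff_le A U W)

lemma continuous_weakStarDist (hA : ∀ n, MeasurableSet (A n)) :
    Continuous fun p : Graphon ν × Graphon ν => weakStarDist A p.1 p.2 := by
  simp_rw [weakStarDist_eq]
  refine continuous_tsum (fun nk => ?_) summable_weights
    fun nk p => weight_mul_abs_rectDiff_le A p.1 p.2 nk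
  have h : Continuous fun U : Graphon ν => ∫ p in A nk.1 ×ˢ A nk.2, U.toAEEqFun p ∂(ν.prod ν) :=
    continuous_setIntegral ((hA _).prod (hA _))
  exact continuous_const.mul ((h.comp continuous_fst).sub (h.comp continuous_snd)).abs

/-- The integral of a graphon over a rectangle depends continuously on the sides. -/
lemma abs_setIntegral_prod_sub_le (U : Graphon ν) {S T S' T' : Set Ω} (hS : MeasurableSet S)
    (hT : MeasurableSet T) (hS' : MeasurableSet S') (hT' : MeasurableSet T') :
    |∫ p in S ×ˢ T, U.toAEEqFun p ∂(ν.prod ν) - ∫ p in S' ×ˢ T', U.toAEEqFun p ∂(ν.prod ν)| ≤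
      ν.real (symmDiff S S') + ν.real (symmDiff T T') := by
  have haux : ∀ {P Q : Set (Ω × Ω)}, MeasurableSet P → MeasurableSet Q →
      (ν.prod ν).real (P \ Q) ≤ ν.real (symmDiff S S') + ν.real (symmDiff T T') →
      ∫ p in P, U.toAEEqFun p ∂(ν.prod ν) - ∫ p in Q, U.toAEEqFun p ∂(ν.prod ν) ≤
        ν.real (symmDiff S S') + ν.real (symmDiff T T') := by
    -- As the values lie in `[0,1]`, the difference of the integrals is at most the measure of `P \
    -- Q`.
    intro P Q hP hQ h
    have h1 := integral_inter_add_sdiff (s := P) hQ U.integrable.integrableOn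
    have h2 := integral_inter_add_sdiff (s := Q) hP U.integrable.integrableOn
    rw [inter_comm] at h2
    have h3 := U.setIntegral_nonneg (Q \ P)
    have h4 := U.setIntegral_le (P \ Q)
    linarith
  have hcov : ∀ {S T S' T' : Set Ω}, (ν.prod ν).real ((S ×ˢ T) \ (S' ×ˢ T')) ≤
      ν.real (symmDiff S S') + ν.real (symmDiff T T') := by
    intro S T S' T'
    calc (ν.prod ν).real ((S ×ˢ T) \ (S' ×ˢ T'))
        ≤ (ν.prod ν).real ((symmDiff S S') ×ˢ univ ∪ univ ×ˢ (symmDiff T T')) := by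
          refine measureReal_mono fun p hp => ?_
          obtain ⟨⟨h1, h2⟩, h3⟩ := hp
          by_cases h : p.1 ∈ S'
          · exact Or.inr ⟨mem_univ _, Or.inl ⟨h2, fun h' => h3 ⟨h, h'⟩⟩⟩
          · exact Or.inl ⟨Or.inl ⟨h1, h⟩, mem_univ _⟩
      _ ≤ _ := (measureReal_union_le _ _).trans (by simp [measureReal_prod_prod])
  rw [abs_le]
  constructor
  · have := haux (hS'.prod hT') (hS.prod hT) (by
      rw [symmDiff_comm S, symmDiff_comm T]; exact hcov)
    linarith
  · exact haux (hS.prod hT) (hS'.prod hT') hcov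

lemma eq_of_weakStarDist_eq_zero (hA : IsDenseInMeasureAlgebra ν A) {U W : Graphon ν}
    (h : weakStarDist A U W = 0) : U = W := by
  have hzero : ∀ n k, ∫ p in A n ×ˢ A k, U.toAEEqFun p ∂(ν.prod ν) =
      ∫ p in A n ×ˢ A k, W.toAEEqFun p ∂(ν.prod ν) := by
    intro n k
    rw [weakStarDist_eq] at h
    have h0 := (hasSum_zero_iff_of_nonneg (fun nk => by positivity)).1
      (h ▸ (summable_weakStarDist A U W).hasSum)
    have h1 := congrFun h0 (n, k)
    simp only [Pi.zero_apply, mul_eq_zero, inv_eq_zero, abs_eq_zero] at h1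
    rcases h1 with h1 | h1
    · exact absurd h1 (by positivity)
    · exact sub_eq_zero.1 h1
  refine ext_of_setIntegral_prod fun S T hS hT => eq_of_forall_dist_le fun ε hε => ?_
  -- Four errors add up: two sides of the rectangle for each of two graphons.
  obtain ⟨n, hn⟩ := hA.2 S hS (ε / 4) (by positivity)
  obtain ⟨k, hk⟩ := hA.2 T hT (ε / 4) (by positivity)
  have hU := abs_le.1 (U.abs_setIntegral_prod_sub_le hS hT (hA.1 n) (hA.1 k))
  have hW := abs_le.1 (W.abs_setIntegral_prod_sub_le hS hT (hA.1 n) (hA.1 k))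
  have := hzero n k
  rw [Real.dist_eq, abs_le]
  constructor <;> linarith [hU.1, hU.2, hW.1, hW.2]

/-- The metric space of graphons with the distance `weakStarDist A`. -/
abbrev weakStarMetricSpace (hA : IsDenseInMeasureAlgebra ν A) : MetricSpace (Graphon ν) where
  dist := weakStarDist A
  dist_self U := by simp [weakStarDist]
  dist_comm U W := by
    simp_rw [weakStarDist_eq]
    exact tsum_congr fun nk => by rw [rectDiff, rectDiff, abs_sub_comm]
  dist_triangle U V W := by
    simp_rw [weakStarDist_eq]
    rw [← (summable_weakStarDist A U V).tsum_add (summable_weakStarDist A V W)]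
    refine (summable_weakStarDist A U W).tsum_le_tsum (fun nk => ?_)
      ((summable_weakStarDist A U V).add (summable_weakStarDist A V W))
    rw [← mul_add]
    exact mul_le_mul_of_nonneg_left (abs_sub_le _ _ _) (by positivity)
  eq_of_dist_eq_zero h := eq_of_weakStarDist_eq_zero hA h

lemma isWeakStarMetric_weakStarDist (hA : IsDenseInMeasureAlgebra ν A) :
    IsWeakStarMetric (ν := ν) (weakStarDist A) := by
  refine ⟨weakStarMetricSpace hA, ?_, fun U W => rfl⟩
  have hc : ∀ W : Graphon ν, Continuous fun U => weakStarDist A U W := fun W =>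
    (continuous_weakStarDist hA.1).comp (Continuous.prodMk continuous_id continuous_const)
  have h := @eq_induced_of_continuous_dist (Graphon ν) (Graphon ν) (weakStarTopology ν)
    inferInstance (weakStarMetricSpace hA) id Function.injective_id hc
  exact (h.trans (@induced_id _
    (weakStarMetricSpace hA).toPseudoMetricSpace.toUniformSpace.toTopologicalSpace)).symm

end WeakStarDist

end Graphon

end

theorem proposition7p2 {Ω : Type*} [MeasurableSpace Ω] [StandardBorelSpace Ω]
    (ν : Measure Ω) [IsProbabilityMeasure ν] [NullSingletonClass ν] (Γ : ℕ → Graphon ν) :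
    (∀ d : Graphon ν → Graphon ν → ℝ, Graphon.IsWeakStarMetric d →
      List.TFAE [
        Graphon.LIM Γ = Graphon.ACC Γ,
        IsCauchyFor (hausdorffDistOf d) (fun n => Graphon.envelope (Γ n)),
        ∀ (q : ℕ) (a : Fin q → ℝ), (∀ i, 0 ≤ a i) → ∑ i, a i = 1 →
          IsCauchyFor (hausdorffDistOf matrixL1Dist) (fun n => Graphon.multiwayCuts a (Γ n))]) ∧
    (∀ A : ℕ → Set Ω, Graphon.IsDenseInMeasureAlgebra ν A →
      List.TFAE [
        Graphon.LIM Γ = Graphon.ACC Γ,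
        IsCauchyFor (hausdorffDistOf (Graphon.weakStarDist A)) (fun n => Graphon.envelope (Γ n)),
        ∀ (q : ℕ) (a : Fin q → ℝ), (∀ i, 0 ≤ a i) → ∑ i, a i = 1 →
          IsCauchyFor (hausdorffDistOf matrixL1Dist)
            (fun n => Graphon.multiwayCuts a (Γ n))]) := by
  exact ⟨fun _ hd => Graphon.tfae_of_isWeakStarMetric Γ hd,
    fun _ hA => Graphon.tfae_of_isWeakStarMetric Γ (Graphon.isWeakStarMetric_weakStarDist hA)⟩
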